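/- Let $d\ge 1$ and let $H=-\Delta+|x|^2$ be the harmonic oscillator on $\mathbb R^d$. Let $(h_n)_{n\in\mathbb N}$ be an orthonormal basis of $L^2(\mathbb R^d)$ consisting of eigenfunctions of $H$ (they are Schwartz functions), $Hh_n=\lambda_n^2h_n$ with $\lambda_n>0$ non-decreasing. For $\sigma\in\mathbb R$ let $\mathcal H^\sigma(\mathbb R^d)$ be the closure (completion inside the tempered distributions) of the Schwartz space for the norm $\|u\|_{\mathcal H^\sigma}=\|H^{\sigma/2}u\|_{L^2(\mathbb R^d)}=\big(\sum_n\lambda_n^{2\sigma}|c_n|^2\big)^{1/2}$, where $c_n=\langle u,\overline{h_n}\rangle$ are the coefficients in $u=\sum_n c_nh_n$. Let $(g_n)_{n\in\mathbb N}$ be independent complex Gaussian random variables on a probability space $(\Omega,\mathcal T,P)$, each with density $\frac1\pi e^{-|z|^2}$ with respect to Lebesgue measure on $\mathbb C$. Let $\sigma\in\mathbb R$ and $u_0=\sum_n c_nh_n\in\mathcal H^\sigma(\mathbb R^d)$, and let $$u_0^\omega=\sum_{n\in\mathbb N}c_n\,g_n(\omega)\,h_n .$$ Then for every $s\ge 0$,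 if $u_0\notin\mathcal H^s(\mathbb R^d)$, then for $P$-almost every $\omega\in\Omega$ the series defining $u_0^\omega$ converges (unconditionally) in the space of tempered distributions, and $$u_0^\omega\notin H^s(\mathbb R^d)\qquad\text{and}\qquad \langle x\rangle^s u_0^\omega\notin L^2(\mathbb R^d),$$ where $H^s(\mathbb R^d)$ is the usual Sobolev space (based on $L^2$) and $\langle x\rangle=(1+|x|^2)^{1/2}$. -/

import Mathlib

open MeasureTheory ProbabilityTheory Filter Topology
open scoped SchwartzMap ENNReal ComplexConjugate

noncomputable section

namespace HarmonicRandomisation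

/-- The harmonic oscillator `H = -Δ + |x|²` acting on Schwartz functions on `ℝ^d`. -/
def harmonicOscillator {d : ℕ} (φ : 𝓢(EuclideanSpace ℝ (Fin d), ℂ)) :
    EuclideanSpace ℝ (Fin d) → ℂ :=
  fun x => -(Laplacian.laplacian φ) x + ((‖x‖ ^ 2 : ℝ) : ℂ) * φ x

/-- An orthonormal (Hilbert) basis `(h_n)` of `L²(ℝ^d)` made of eigenvectors of the harmonic
oscillator, with `H h_n = λ_n² h_n` and `(λ_n)` positive and non-decreasing.  The `h_n` are taken in
the Schwartz space, the domain on which `H` acts; all eigenvectors of `H` lie there. -/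
structure HermiteBasis (d : ℕ) where
  /-- the eigenfunctions `h_n` -/
  h : ℕ → 𝓢(EuclideanSpace ℝ (Fin d), ℂ)
  /-- the numbers `λ_n`, the square roots of the eigenvalues -/
  freq : ℕ → ℝ
  freq_pos : ∀ n, 0 < freq n
  freq_mono : Monotone freq
  eigen : ∀ n x, harmonicOscillator (h n) x = ((freq n ^ 2 : ℝ) : ℂ) * h n x
  orthonormal : Orthonormal ℂ
    (fun n => (h n).toLp 2 (volume : Measure (EuclideanSpace ℝ (Fin d))))
  complete : (Submodule.span ℂ (Set.range
    (fun n => (h n).toLp 2 (volume : Measure (EuclideanSpace ℝ (Fin d)))))).topologicalClosure = ⊤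

variable {d : ℕ}

/-- The coefficient `c_n = ⟨u, conj h_n⟩` of a tempered distribution `u` along `h_n`; for a function
`u` this is the `L²` inner product `∫ conj (h_n) u`. -/
def coeff (b : HermiteBasis d) (u : 𝓢'(EuclideanSpace ℝ (Fin d), ℂ)) (n : ℕ) : ℂ :=
  u (SchwartzMap.postcompCLM (𝕜 := ℝ) (Complex.conjCLE : ℂ →L[ℝ] ℂ) (b.h n))

/-- `h_n` as a tempered distribution. -/
def basisDist (b : HermiteBasis d) (n : ℕ) : 𝓢'(EuclideanSpace ℝ (Fin d), ℂ) :=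
  SchwartzMap.toTemperedDistributionCLM (EuclideanSpace ℝ (Fin d)) ℂ volume (b.h n)

/-- The norm `‖φ‖_{𝓗^s} = ‖H^{s/2} φ‖_{L²}` of a Schwartz function, where
`H^{s/2} φ = ∑ λ_n^s c_n(φ) h_n`. -/
def harmonicNorm (b : HermiteBasis d) (s : ℝ) (φ : 𝓢(EuclideanSpace ℝ (Fin d), ℂ)) : ℝ≥0∞ :=
  (∑' n, (ENNReal.ofReal (b.freq n ^ s) *
    ‖coeff b (SchwartzMap.toTemperedDistributionCLM (EuclideanSpace ℝ (Fin d)) ℂ volume φ) n‖ₑ)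
      ^ (2 : ℕ)) ^ (1 / 2 : ℝ)

/-- The harmonic Sobolev space `𝓗^s(ℝ^d)`: the closure (completion) of the Schwartz space for the
norm `‖H^{s/2} φ‖_{L²}`, realised inside the tempered distributions as the set of limits of those
sequences of Schwartz functions that are Cauchy for this norm. -/
def MemHarmonicSobolev (b : HermiteBasis d) (s : ℝ)
    (u : 𝓢'(EuclideanSpace ℝ (Fin d), ℂ)) : Prop :=
  ∃ φ : ℕ → 𝓢(EuclideanSpace ℝ (Fin d), ℂ),
    (∀ ε : ℝ≥0∞, 0 < ε → ∃ N : ℕ, ∀ j ≥ N, ∀ k ≥ N, harmonicNorm b s (φ j - φ k) < ε) ∧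
    Tendsto (fun k => SchwartzMap.toTemperedDistributionCLM (EuclideanSpace ℝ (Fin d)) ℂ volume
      (φ k)) atTop (𝓝 u)

/-- The law `𝓝_ℂ(0,1)`, with density `π⁻¹ exp (-|z|²)` with respect to Lebesgue measure on `ℂ`. -/
def stdComplexGaussian : Measure ℂ :=
  (volume : Measure ℂ).withDensity
    (fun z => ENNReal.ofReal (1 / Real.pi * Real.exp (-‖z‖ ^ 2)))

/-- The `n`-th term `c_n g_n(ω) h_n` of the randomisation of `u₀`. -/
def randomTerm {Ω : Type*} (b : HermiteBasis d) (g : ℕ → Ω → ℂ)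
    (u₀ : 𝓢'(EuclideanSpace ℝ (Fin d), ℂ)) (ω : Ω) (n : ℕ) :
    𝓢'(EuclideanSpace ℝ (Fin d), ℂ) :=
  (coeff b u₀ n * g n ω) • basisDist b n

/-- The randomisation `u₀^ω = ∑ c_n g_n(ω) h_n`, a series of tempered distributions. -/
def randomisation {Ω : Type*} (b : HermiteBasis d) (g : ℕ → Ω → ℂ)
    (u₀ : 𝓢'(EuclideanSpace ℝ (Fin d), ℂ)) (ω : Ω) :
    𝓢'(EuclideanSpace ℝ (Fin d), ℂ) :=
  ∑' n, randomTerm b g u₀ ω n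

/-- `⟨x⟩^s = (1 + |x|²)^{s/2}`. -/
def japaneseBracketPow (d : ℕ) (s : ℝ) : EuclideanSpace ℝ (Fin d) → ℂ :=
  fun x => (((1 + ‖x‖ ^ 2) ^ (s / 2) : ℝ) : ℂ)

/-- Multiplication of tempered distributions by `⟨x⟩^s` is meaningful. -/
theorem japaneseBracketPow_hasTemperateGrowth (d : ℕ) (s : ℝ) :
    (japaneseBracketPow d s).HasTemperateGrowth := by
  unfold japaneseBracketPow
  fun_prop

/-- The tempered distribution `u` is (given by) a function in `L²(ℝ^d)`. -/
def MemL2 (u : 𝓢'(EuclideanSpace ℝ (Fin d), ℂ)) : Prop :=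
  ∃ f : Lp ℂ 2 (volume : Measure (EuclideanSpace ℝ (Fin d))),
    u = MeasureTheory.Lp.toTemperedDistribution f

end HarmonicRandomisation

end

open MeasureTheory ProbabilityTheory Filter Topology
open scoped SchwartzMap ENNReal ComplexConjugate

noncomputable section

namespace HarmonicRandomisation

/-! ### Gaussian vectors: Laplace transforms and almost sure divergence -/

section Gaussian

/-! Each negative conclusion says that `A u₀^ω` is not in `L²`, with `A` either the Bessel potential
or multiplication by `⟨x⟩^s`. In the basis `h_k` this is a Gaussian series with total variance `∑
|c_n|² ‖A h_n‖²`. Two facts suffice: a Gaussian series of infinite total variance is almost surely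
not in `ℓ²` (`ae_not_summable_of_tsum_eq_top`), and `‖A h_n‖² ≥ c λ_n^{2s}`. They combine in
`ae_not_memL2_map_randomisation`, since `u₀ ∉ 𝓗^s` forces `∑ λ_n^{2s} |c_n|² = ∞`.

For the first fact, `E exp(-‖∑ g_i v_i‖²) = 1 / det(1 + cov) ≤ 1 / (1 + ∑ ‖v_i‖²)`; the bound is
obtained by integrating out one Gaussian at a time. By Fatou, infinite variance makes the
exponential of minus the squared `ℓ²` norm vanish almost surely.

For the second, the virial identity gives `|x|²` the mean `λ_n²/2` under the density `|h_n|²`, and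
the commutation relations give `|x|⁴` a mean of order at most `λ_n⁴`. A Paley-Zygmund type argument
then bounds the mean of `|x|^{2s}` below by `c λ_n^{2s}` (`exists_lower_bound_weighted_norm`). The
Fourier transform of `h_n` is an eigenfunction of a rescaled oscillator, so the Sobolev norm obeys
the same bound.

For convergence, `u₀ = H^m F` with `F ∈ L²`. The randomised coefficients of `F` are almost surely
square summable, and `H^m` is continuous on tempered distributions. -/

lemma norm_sq_add_norm_add_smul_sq {V : Type*} [NormedAddCommGroup V] [InnerProductSpace ℂ V]
    (x v : V) (z : ℂ) :
    ‖z‖ ^ 2 + ‖x + z • v‖ ^ 2 =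
      (1 + ‖v‖ ^ 2) * ‖z + inner ℂ v x / (1 + ‖v‖ ^ 2 : ℝ)‖ ^ 2 +
        (‖x‖ ^ 2 - ‖inner ℂ v x‖ ^ 2 / (1 + ‖v‖ ^ 2)) := by
  have ha : (1 + ‖v‖ ^ 2 : ℝ) ≠ 0 := by positivity
  have h1 : ‖x + z • v‖ ^ 2 = ‖x‖ ^ 2 + 2 * (conj z * inner ℂ v x).re + ‖z‖ ^ 2 * ‖v‖ ^ 2 := by
    rw [@norm_add_sq ℂ, norm_smul, mul_pow, ← inner_smul_left, ← inner_conj_symm, RCLike.conj_re]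
    rfl
  have h2 : ‖z + inner ℂ v x / (1 + ‖v‖ ^ 2 : ℝ)‖ ^ 2 = ‖z‖ ^ 2 +
      2 * ((conj z * inner ℂ v x).re / (1 + ‖v‖ ^ 2)) +
      ‖inner ℂ v x‖ ^ 2 / (1 + ‖v‖ ^ 2) ^ 2 := by
    rw [@norm_add_sq ℂ, norm_div, div_pow, Complex.norm_real, Real.norm_eq_abs, sq_abs,
      RCLike.inner_apply, div_mul_eq_mul_div, mul_comm (inner ℂ v x) (conj z)]
    congr 3
    exact Complex.div_ofReal_re _ _
  rw [h1, h2]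
  field_simp
  ring

/-- Completing the square in `z` leaves a Gaussian integral over a real plane, equal to `π / (1 +
‖v‖²)`, whose `π` cancels the normalisation of the law. -/
lemma lintegral_exp_neg_norm_sq_add_smul {V : Type*} [NormedAddCommGroup V]
    [InnerProductSpace ℂ V] (x v : V) :
    ∫⁻ z, ENNReal.ofReal (Real.exp (-‖x + z • v‖ ^ 2)) ∂stdComplexGaussian =
      ENNReal.ofReal ((1 + ‖v‖ ^ 2)⁻¹ *
        Real.exp (-(‖x‖ ^ 2 - ‖inner ℂ v x‖ ^ 2 / (1 + ‖v‖ ^ 2)))) := by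
  have ha : (0 : ℝ) < 1 + ‖v‖ ^ 2 := by positivity
  set a : ℝ := 1 + ‖v‖ ^ 2 with ha'
  set q : ℝ := ‖x‖ ^ 2 - ‖inner ℂ v x‖ ^ 2 / a with hq
  have hint := GaussianFourier.integral_rexp_neg_mul_sq_norm (V := ℂ) ha
  -- Integrability is read off from the nonzero value: a non-integrable function would have integral
  -- `0`.
  have hint' : Integrable (fun z : ℂ => Real.exp (-a * ‖z‖ ^ 2)) := by
    by_contra h
    rw [integral_undef h] at hint
    have : (0 : ℝ) < (Real.pi / a) ^ (Module.finrank ℝ ℂ / 2 : ℝ) := by positivity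
    linarith
  have hmeas : Measurable fun z : ℂ => ENNReal.ofReal (Real.exp (-‖x + z • v‖ ^ 2)) :=
    ENNReal.measurable_ofReal.comp
      (show Continuous fun z : ℂ => Real.exp (-‖x + z • v‖ ^ 2) by fun_prop).measurable
  rw [stdComplexGaussian, lintegral_withDensity_eq_lintegral_mul _ (by fun_prop) hmeas]
  have : ∀ z : ℂ, ((fun z : ℂ => ENNReal.ofReal (1 / Real.pi * Real.exp (-‖z‖ ^ 2))) *
      fun z : ℂ => ENNReal.ofReal (Real.exp (-‖x + z • v‖ ^ 2))) z =
      ENNReal.ofReal (1 / Real.pi * Real.exp (-q)) *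
        ENNReal.ofReal (Real.exp (-a * ‖z + inner ℂ v x / a‖ ^ 2)) := by
    intro z
    rw [Pi.mul_apply, ← ENNReal.ofReal_mul (by positivity), ← ENNReal.ofReal_mul (by positivity),
      mul_assoc, mul_assoc, ← Real.exp_add, ← Real.exp_add]
    congr 3
    have := norm_sq_add_norm_add_smul_sq x v z
    rw [← ha', ← hq] at this
    linarith
  simp_rw [this]
  rw [lintegral_const_mul _ (by fun_prop),
    lintegral_add_right_eq_self (μ := (volume : Measure ℂ))
      (fun z : ℂ => ENNReal.ofReal (Real.exp (-a * ‖z‖ ^ 2))) (inner ℂ v x / a),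
    ← ofReal_integral_eq_lintegral_ofReal hint' (ae_of_all _ fun _ => by positivity), hint,
    ← ENNReal.ofReal_mul (by positivity)]
  congr 1
  rw [Complex.finrank_real_complex]
  norm_num
  field_simp

/-- The square root of `1 - v v^* / (1 + ‖v‖²)`. -/
lemma exists_linearMap_norm_sq_eq {V : Type*} [NormedAddCommGroup V] [InnerProductSpace ℂ V]
    (v : V) : ∃ T : V →ₗ[ℂ] V, ∀ x,
      ‖T x‖ ^ 2 = ‖x‖ ^ 2 - ‖inner ℂ v x‖ ^ 2 / (1 + ‖v‖ ^ 2) := by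
  obtain ⟨r, hr, hr2⟩ : ∃ r : ℝ, 0 < r ∧ r ^ 2 = 1 + ‖v‖ ^ 2 :=
    ⟨√(1 + ‖v‖ ^ 2), by positivity, Real.sq_sqrt (by positivity)⟩
  -- With this `c`, the operator `1 - c v v^*` multiplies `v` by `1 - (r² - 1) / (r (r + 1)) = 1 /
  -- r`, the square root of `1 - ‖v‖² / (1 + ‖v‖²)`.
  let c : ℝ := (r * (r + 1))⁻¹
  refine ⟨LinearMap.id - (c : ℂ) • (innerₛₗ ℂ v).smulRight v, fun x => ?_⟩
  have h1 : (LinearMap.id - (c : ℂ) • (innerₛₗ ℂ v).smulRight v : V →ₗ[ℂ] V) x =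
      x - ((c : ℂ) * inner ℂ v x) • v := by
    simp [mul_smul]
  rw [h1, @norm_sub_sq ℂ, norm_smul, inner_smul_right, mul_assoc, ← inner_conj_symm x v,
    RCLike.mul_conj, norm_mul, Complex.norm_real, mul_pow, mul_pow, Real.norm_eq_abs, sq_abs]
  have h2 : RCLike.re ((c : ℂ) * ((‖inner ℂ v x‖ : ℝ) : ℂ) ^ 2) = c * ‖inner ℂ v x‖ ^ 2 := by
    norm_cast
  have hv : ‖v‖ ^ 2 = r ^ 2 - 1 := by linarith
  have h3 : RCLike.re ((c : ℂ) * ((RCLike.ofReal ‖inner ℂ v x‖ : ℂ)) ^ 2) =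
    c * ‖inner ℂ v x‖ ^ 2 := h2
  rw [h3, hv]
  simp only [c]
  have hr1 : r + 1 ≠ 0 := by positivity
  have : 1 + (r ^ 2 - 1) = r ^ 2 := by ring
  rw [this]
  field_simp
  ring

variable {Ω : Type*} [MeasurableSpace Ω] {P : Measure Ω} [IsProbabilityMeasure P]
  {g : ℕ → Ω → ℂ}

/-- The Laplace transform of the squared norm of a Gaussian vector is controlled by the trace of
its covariance. -/
lemma lintegral_exp_neg_norm_sum_smul_sq_le {V : Type*} [NormedAddCommGroup V]
    [InnerProductSpace ℂ V] [MeasurableSpace V] [BorelSpace V] [SecondCountableTopology V]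
    (hg_meas : ∀ n, Measurable (g n)) (hg_indep : iIndepFun g P)
    (hg_law : ∀ n, P.map (g n) = stdComplexGaussian) (M : ℕ) (v : ℕ → V) :
    ∫⁻ ω, ENNReal.ofReal (Real.exp (-‖∑ i ∈ Finset.range M, g i ω • v i‖ ^ 2)) ∂P ≤
      ENNReal.ofReal (1 + ∑ i ∈ Finset.range M, ‖v i‖ ^ 2)⁻¹ := by
  induction M generalizing v with
  | zero => simp
  | succ M ih =>
    obtain ⟨T, hT⟩ := exists_linearMap_norm_sq_eq (v M)
    set X : Ω → V := fun ω => ∑ i ∈ Finset.range M, g i ω • v i with hX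
    have hXm : Measurable X := by fun_prop
    have hind : IndepFun X (g M) P := by
      have := hg_indep.indepFun_finset (Finset.range M) {M} (by simp) hg_meas
      have hφ : Measurable fun a : Finset.range M → ℂ => ∑ i, a i • v i := by fun_prop
      have hψ : Measurable fun a : ({M} : Finset ℕ) → ℂ => a ⟨M, Finset.mem_singleton_self M⟩ :=
        measurable_pi_apply _
      have h2 := this.comp hφ hψ
      have hXeq : X = (fun a : Finset.range M → ℂ => ∑ i, a i • v i) ∘ fun ω i => g i ω := by
        ext ω
        exact (Finset.sum_coe_sort (Finset.range M) (fun i => g i ω • v i)).symm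
      rw [hXeq]
      exact h2
    -- Integrating out the last Gaussian replaces every remaining vector by its image under `T`, at
    -- the price of the factor `(1 + ‖v M‖²)⁻¹`; the induction hypothesis then applies to `T (v i)`.
    have key : ∫⁻ ω, ENNReal.ofReal (Real.exp (-‖X ω + g M ω • v M‖ ^ 2)) ∂P =
        ∫⁻ ω, ENNReal.ofReal ((1 + ‖v M‖ ^ 2)⁻¹ * Real.exp (-‖T (X ω)‖ ^ 2)) ∂P := by
      have hsf : SFinite stdComplexGaussian := by rw [← hg_law 0]; infer_instance
      calc _ = ∫⁻ p, ENNReal.ofReal (Real.exp (-‖p.1 + p.2 • v M‖ ^ 2))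
              ∂(P.map (fun ω => (X ω, g M ω))) := by
            rw [lintegral_map (by fun_prop) (by fun_prop)]
        _ = ∫⁻ x, ∫⁻ z, ENNReal.ofReal (Real.exp (-‖x + z • v M‖ ^ 2))
              ∂stdComplexGaussian ∂(P.map X) := by
            rw [(indepFun_iff_map_prod_eq_prod_map_map hXm.aemeasurable
              (hg_meas M).aemeasurable).1 hind, hg_law M, lintegral_prod _ (by fun_prop)]
        _ = _ := by
            simp_rw [lintegral_exp_neg_norm_sq_add_smul, ← hT]
            rw [lintegral_map _ hXm]
            simp_rw [hT]
            fun_prop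
    simp_rw [Finset.sum_range_succ]
    rw [key]
    simp_rw [ENNReal.ofReal_mul (show (0 : ℝ) ≤ (1 + ‖v M‖ ^ 2)⁻¹ by positivity)]
    rw [lintegral_const_mul']
    swap; · simp
    simp_rw [hX, map_sum, map_smul]
    refine (mul_le_mul_right (ih (fun i => T (v i))) _).trans ?_
    rw [← ENNReal.ofReal_mul (by positivity), ← mul_inv]
    refine ENNReal.ofReal_le_ofReal ?_
    refine inv_anti₀ (by positivity) ?_
    -- Cauchy-Schwarz: `T` shrinks squared norms by at most the factor `1 + ‖v M‖²`, so the product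
    -- of the two factors dominates the full trace.
    have h1 : ∀ i, ‖v i‖ ^ 2 ≤ (1 + ‖v M‖ ^ 2) * ‖T (v i)‖ ^ 2 := by
      intro i
      have := norm_inner_le_norm (𝕜 := ℂ) (v M) (v i)
      have h2 : ‖inner ℂ (v M) (v i)‖ ^ 2 ≤ (‖v M‖ * ‖v i‖) ^ 2 := by gcongr
      rw [hT, mul_sub, mul_div_cancel₀ _ (by positivity)]
      nlinarith
    have h3 := Finset.sum_le_sum (fun i (_ : i ∈ Finset.range M) => h1 i)
    rw [← Finset.mul_sum] at h3
    linarith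

/-- A Gaussian series in `ℓ²` whose coefficients are not square summable diverges almost surely. -/
lemma ae_not_summable_of_tsum_eq_top
    (hg_meas : ∀ n, Measurable (g n)) (hg_indep : iIndepFun g P)
    (hg_law : ∀ n, P.map (g n) = stdComplexGaussian) (w : ℕ → ℕ → ℂ)
    (hw : ∑' n, ∑' k, ‖w n k‖ₑ ^ 2 = ∞) :
    ∀ᵐ ω ∂P, ∀ y : ℕ → ℂ,
      (∀ k, Tendsto (fun M => ∑ n ∈ Finset.range M, g n ω * w n k) atTop (𝓝 (y k))) →
      ¬ Summable fun k => ‖y k‖ ^ 2 := by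
  -- `M` truncates the series and `K` the coordinates, so that the finite-dimensional Laplace bound
  -- applies.
  let F : ℕ → ℕ → Ω → ℝ≥0∞ := fun K M ω =>
    ENNReal.ofReal (Real.exp (-∑ k ∈ Finset.range K, ‖∑ n ∈ Finset.range M, g n ω * w n k‖ ^ 2))
  have hF : ∀ K M, Measurable (F K M) := by intro K M; fun_prop
  have hFint : ∀ K M, ∫⁻ ω, F K M ω ∂P ≤ ENNReal.ofReal
      (1 + ∑ n ∈ Finset.range M, ∑ k ∈ Finset.range K, ‖w n k‖ ^ 2)⁻¹ := by
    intro K M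
    have := lintegral_exp_neg_norm_sum_smul_sq_le hg_meas hg_indep hg_law M
      (fun n => (WithLp.toLp 2 (fun k : Fin K => w n k) : EuclideanSpace ℂ (Fin K)))
    simpa [EuclideanSpace.norm_sq_eq, F, Finset.sum_range] using this
  -- Fatou in `M` at fixed `K`; the bounds decrease in `M`, so each fixed `M₀` serves.
  have hint : ∀ K M₀, ∫⁻ ω, liminf (fun M => F K M ω) atTop ∂P ≤ ENNReal.ofReal
      (1 + ∑ n ∈ Finset.range M₀, ∑ k ∈ Finset.range K, ‖w n k‖ ^ 2)⁻¹ := by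
    intro K M₀
    refine (lintegral_liminf_le (hF K)).trans ?_
    refine liminf_le_of_frequently_le' (Eventually.frequently ?_)
    filter_upwards [eventually_ge_atTop M₀] with M hM
    refine (hFint K M).trans (ENNReal.ofReal_le_ofReal (inv_anti₀ (by positivity) ?_))
    gcongr
  have hzero : ∫⁻ ω, ⨅ K, liminf (fun M => F K M ω) atTop ∂P = 0 := by
    rw [← nonpos_iff_eq_zero]
    refine ENNReal.le_of_forall_pos_le_add fun ε hε _ => ?_
    rw [zero_add]
    obtain ⟨K, M₀, hKM⟩ : ∃ K M₀, (ε : ℝ)⁻¹ <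
        ∑ n ∈ Finset.range M₀, ∑ k ∈ Finset.range K, ‖w n k‖ ^ 2 := by
      by_contra! hcon
      have hle : ∀ M₀, ∑ n ∈ Finset.range M₀, ∑' k, ‖w n k‖ₑ ^ 2 ≤
          ENNReal.ofReal (ε : ℝ)⁻¹ := by
        intro M₀
        have ht : Tendsto (fun K => ∑ n ∈ Finset.range M₀, ∑ k ∈ Finset.range K, ‖w n k‖ₑ ^ 2)
            atTop (𝓝 (∑ n ∈ Finset.range M₀, ∑' k, ‖w n k‖ₑ ^ 2)) :=
          tendsto_finsetSum _ fun n _ => ENNReal.tendsto_nat_tsum _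
        refine le_of_tendsto' ht fun K => ?_
        refine le_trans (le_of_eq ?_) (ENNReal.ofReal_le_ofReal (hcon K M₀))
        rw [ENNReal.ofReal_sum_of_nonneg (fun _ _ => by positivity)]
        refine Finset.sum_congr rfl fun n _ => ?_
        rw [ENNReal.ofReal_sum_of_nonneg (fun _ _ => by positivity)]
        refine Finset.sum_congr rfl fun k _ => ?_
        rw [ENNReal.ofReal_pow (norm_nonneg _), ofReal_norm]
      have := le_of_tendsto' (ENNReal.tendsto_nat_tsum _) hle
      rw [hw] at this
      exact absurd this (by simp)
    calc _ ≤ ∫⁻ ω, liminf (fun M => F K M ω) atTop ∂P :=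
          lintegral_mono fun ω => iInf_le _ K
      _ ≤ _ := hint K M₀
      _ ≤ ENNReal.ofReal ε := by
          refine ENNReal.ofReal_le_ofReal ?_
          have hε' : (0 : ℝ) < ε := hε
          rw [inv_le_comm₀ (by positivity) hε']
          linarith
      _ = ε := ENNReal.ofReal_coe_nnreal
  rw [lintegral_eq_zero_iff (by
    exact Measurable.iInf fun K => Measurable.liminf (hF K))] at hzero
  filter_upwards [hzero] with ω hω y hy hsum
  -- Were `y` square summable, one positive number would bound all the liminfs from below, whereas
  -- their infimum over `K` is `0`.
  have hlow : ENNReal.ofReal (Real.exp (-∑' k, ‖y k‖ ^ 2)) ≤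
      ⨅ K, liminf (fun M => F K M ω) atTop := by
    refine le_iInf fun K => ?_
    have ht : Tendsto (fun M => F K M ω) atTop
        (𝓝 (ENNReal.ofReal (Real.exp (-∑ k ∈ Finset.range K, ‖y k‖ ^ 2)))) := by
      refine ENNReal.tendsto_ofReal ((Real.continuous_exp.tendsto _).comp ?_)
      exact (tendsto_finsetSum _ fun k _ => ((hy k).norm.pow 2)).neg
    rw [ht.liminf_eq]
    refine ENNReal.ofReal_le_ofReal (Real.exp_le_exp.2 (neg_le_neg ?_))
    exact hsum.sum_le_tsum _ (fun _ _ => by positivity)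
  rw [hω] at hlow
  simp only [Pi.zero_apply, nonpos_iff_eq_zero, ENNReal.ofReal_eq_zero] at hlow
  exact absurd (Real.exp_pos _) (not_lt.2 hlow)

lemma lintegral_enorm_sq_stdComplexGaussian_ne_top :
    ∫⁻ z, ‖z‖ₑ ^ 2 ∂stdComplexGaussian ≠ ∞ := by
  have hint := GaussianFourier.integral_rexp_neg_mul_sq_norm (V := ℂ) (b := 1 / 2) (by norm_num)
  have hint' : Integrable (fun z : ℂ => Real.exp (-(1 / 2) * ‖z‖ ^ 2)) := by
    by_contra h
    rw [integral_undef h] at hint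
    have : (0 : ℝ) < (Real.pi / (1 / 2)) ^ (Module.finrank ℝ ℂ / 2 : ℝ) := by positivity
    linarith
  rw [stdComplexGaussian, lintegral_withDensity_eq_lintegral_mul _ (by fun_prop) (by fun_prop)]
  refine ne_top_of_le_ne_top (b := ∫⁻ z : ℂ, ENNReal.ofReal
    (2 / Real.pi * Real.exp (-(1 / 2) * ‖z‖ ^ 2))) ?_ (lintegral_mono fun z => ?_)
  · exact (hint'.const_mul (2 / Real.pi)).lintegral_lt_top.ne
  · rw [Pi.mul_apply, ← ofReal_norm, ← ENNReal.ofReal_pow (norm_nonneg _),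
      ← ENNReal.ofReal_mul (by positivity)]
    refine ENNReal.ofReal_le_ofReal ?_
    -- The polynomial factor is absorbed by half of the Gaussian exponent.
    have h1 : ‖z‖ ^ 2 ≤ 2 * Real.exp (1 / 2 * ‖z‖ ^ 2) := by
      have := Real.add_one_le_exp (1 / 2 * ‖z‖ ^ 2)
      linarith
    have h2 : Real.exp (-(1 / 2) * ‖z‖ ^ 2) =
        Real.exp (-‖z‖ ^ 2) * Real.exp (1 / 2 * ‖z‖ ^ 2) := by
      rw [← Real.exp_add]; congr 1; ring
    rw [h2]
    calc _ ≤ 1 / Real.pi * Real.exp (-‖z‖ ^ 2) * (2 * Real.exp (1 / 2 * ‖z‖ ^ 2)) := by gcongr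
      _ = _ := by ring

omit [IsProbabilityMeasure P] in
-- By Tonelli the sum has finite expectation, a second moment times `∑ ‖a n‖²`.
lemma ae_summable_norm_mul_sq (hg_meas : ∀ n, Measurable (g n))
    (hg_law : ∀ n, P.map (g n) = stdComplexGaussian) {a : ℕ → ℂ}
    (ha : Summable fun n => ‖a n‖ ^ 2) :
    ∀ᵐ ω ∂P, Summable fun n => ‖a n * g n ω‖ ^ 2 := by
  have h1 : ∫⁻ ω, ∑' n, ‖a n * g n ω‖ₑ ^ 2 ∂P ≠ ∞ := by
    rw [lintegral_tsum (fun n => by fun_prop)]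
    simp_rw [enorm_mul, mul_pow]
    have : ∀ n, ∫⁻ ω, ‖a n‖ₑ ^ 2 * ‖g n ω‖ₑ ^ 2 ∂P =
        ‖a n‖ₑ ^ 2 * ∫⁻ z, ‖z‖ₑ ^ 2 ∂stdComplexGaussian := by
      intro n
      rw [lintegral_const_mul _ (by fun_prop), ← hg_law n, lintegral_map (by fun_prop) (hg_meas n)]
    simp_rw [this]
    rw [ENNReal.tsum_mul_right]
    refine ENNReal.mul_ne_top ?_ lintegral_enorm_sq_stdComplexGaussian_ne_top
    simpa [← ofReal_norm, ← ENNReal.ofReal_pow] using ha.tsum_ofReal_ne_top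
  filter_upwards [ae_lt_top' (by fun_prop) h1] with ω hω
  have := ENNReal.summable_toReal hω.ne
  simpa using this

end Gaussian

/-! ### Moment identities from the canonical commutation relations -/

section Virial

variable {S H : Type*} [AddCommGroup S] [Module ℂ S] [NormedAddCommGroup H]
  [InnerProductSpace ℂ H] {J : S →ₗ[ℂ] H} {ι : Type*} [Fintype ι] [DecidableEq ι]
  {X D : ι → S →ₗ[ℂ] S}

/-- The virial theorem for eigenvectors of `-α ∑ D_i² + β ∑ X_i²`, where the `X_i` and the `D_i`
satisfy the canonical commutation relations. -/
lemma virial_identity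
    (hX : ∀ i f g, inner ℂ (J (X i f)) (J g) = inner ℂ (J f) (J (X i g)))
    (hD : ∀ i f g, inner ℂ (J (D i f)) (J g) = -inner ℂ (J f) (J (D i g)))
    (hXX : ∀ i j f, X i (X j f) = X j (X i f)) (hDD : ∀ i j f, D i (D j f) = D j (D i f))
    (hDX : ∀ i j f, D i (X j f) = X j (D i f) + if i = j then f else 0)
    {α β μ : ℝ} {h : S}
    (heig : -(α : ℂ) • ∑ i, D i (D i h) + (β : ℂ) • ∑ i, X i (X i h) = (μ : ℂ) • h) :
    β * ∑ i, ‖J (X i h)‖ ^ 2 = μ / 2 * ‖J h‖ ^ 2 := by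
  have hDDX : ∀ i j f, D i (D i (X j f)) =
      X j (D i (D i f)) + if i = j then (2 : ℂ) • D i f else 0 := by
    intro i j f
    rw [hDX, map_add, hDX]
    split_ifs with hij
    · subst hij; rw [two_smul]; abel
    · simp
  have hXXD : ∀ i j f, X i (X i (D j f)) =
      D j (X i (X i f)) - if i = j then (2 : ℂ) • X i f else 0 := by
    intro i j f
    rw [hDX, hDX, map_add]
    by_cases hij : i = j
    · subst hij; simp only [if_true]; rw [two_smul]; abel
    · simp [hij, Ne.symm hij]
  have hinnD : ∀ i, inner ℂ (J h) (J (D i (D i h))) = -((‖J (D i h)‖ ^ 2 : ℝ) : ℂ) := by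
    intro i
    rw [eq_neg_iff_add_eq_zero, ← neg_eq_iff_add_eq_zero, ← hD, inner_self_eq_norm_sq_to_K]
    norm_cast
  have hinnX : ∀ i, inner ℂ (J h) (J (X i (X i h))) = ((‖J (X i h)‖ ^ 2 : ℝ) : ℂ) := by
    intro i
    rw [← hX, inner_self_eq_norm_sq_to_K]
    norm_cast
  have hsum : α * ∑ i, ‖J (D i h)‖ ^ 2 + β * ∑ i, ‖J (X i h)‖ ^ 2 = μ * ‖J h‖ ^ 2 := by
    have := congrArg (fun f => inner ℂ (J h) (J f)) heig
    simp only [map_add, map_smul, map_sum, inner_add_right, inner_smul_right, inner_sum, hinnD,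
      hinnX, inner_self_eq_norm_sq_to_K] at this
    have h2 : ((α * ∑ i, ‖J (D i h)‖ ^ 2 + β * ∑ i, ‖J (X i h)‖ ^ 2 : ℝ) : ℂ) =
        ((μ * ‖J h‖ ^ 2 : ℝ) : ℂ) := by
      push_cast
      simpa using this
    exact_mod_cast h2
  -- `G` is the dilation generator applied to `h`. Its commutator with the oscillator is `-2 (α ∑
  -- D_i² + β ∑ X_i²)`, whose expectation in an eigenvector vanishes by symmetry. Hence kinetic and
  -- potential energies agree, each being half of the total.
  set G : S := ∑ j, X j (D j h) with hG
  have hLG : -(α : ℂ) • ∑ i, D i (D i G) + (β : ℂ) • ∑ i, X i (X i G) = (μ : ℂ) • G -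
      (2 : ℂ) • ((α : ℂ) • ∑ i, D i (D i h) + (β : ℂ) • ∑ i, X i (X i h)) := by
    have h1 : ∑ i, D i (D i G) = ∑ j, X j (D j (∑ i, D i (D i h))) +
        (2 : ℂ) • ∑ i, D i (D i h) := by
      simp only [hG, map_sum, hDDX, Finset.sum_add_distrib, Finset.sum_ite_eq, Finset.mem_univ,
        if_true, Finset.smul_sum]
      congr 1
      rw [Finset.sum_comm]
      refine Finset.sum_congr rfl fun j _ => Finset.sum_congr rfl fun i _ => ?_
      rw [hDD i j, hDD i j]
    have h2 : ∑ i, X i (X i G) = ∑ j, X j (D j (∑ i, X i (X i h))) -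
        (2 : ℂ) • ∑ i, X i (X i h) := by
      have : ∀ i j, X i (X i (X j (D j h))) =
          X j (D j (X i (X i h))) - if i = j then (2 : ℂ) • X i (X i h) else 0 := by
        intro i j
        rw [hXX i j, hXX i j, hXXD, map_sub]
        split_ifs with hij
        · subst hij; simp
        · simp
      simp only [hG, map_sum, this, Finset.sum_sub_distrib, Finset.sum_ite_eq, Finset.mem_univ,
        if_true, Finset.smul_sum]
      congr 1
      rw [Finset.sum_comm]
    have h3 : ∑ j, X j (D j (-(α : ℂ) • ∑ i, D i (D i h) + (β : ℂ) • ∑ i, X i (X i h))) =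
        (μ : ℂ) • G := by
      rw [heig]; simp only [hG, map_smul, Finset.smul_sum]
    rw [← h3, h1, h2]
    simp only [map_add, map_smul, Finset.sum_add_distrib, ← Finset.smul_sum]
    module
  have hsymm : inner ℂ (J h) (J (-(α : ℂ) • ∑ i, D i (D i G) + (β : ℂ) • ∑ i, X i (X i G))) =
      inner ℂ (J (-(α : ℂ) • ∑ i, D i (D i h) + (β : ℂ) • ∑ i, X i (X i h))) (J G) := by
    simp only [map_add, map_smul, map_sum, inner_add_right, inner_add_left, inner_smul_right,
      inner_smul_left, inner_sum, sum_inner, hX, hD, map_neg, Complex.conj_ofReal, neg_neg]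
  rw [hLG, heig, map_sub, inner_sub_right, map_smul J (μ : ℂ) G, map_smul J (μ : ℂ) h, inner_smul_right,
    inner_smul_left, Complex.conj_ofReal, sub_eq_self, map_smul, inner_smul_right] at hsymm
  have hzero : inner ℂ (J h) (J ((α : ℂ) • ∑ i, D i (D i h) + (β : ℂ) • ∑ i, X i (X i h))) = 0 :=
    (mul_eq_zero.1 hsymm).resolve_left two_ne_zero
  have hdiff : -(α * ∑ i, ‖J (D i h)‖ ^ 2) + β * ∑ i, ‖J (X i h)‖ ^ 2 = 0 := by
    simp only [map_add, map_smul, map_sum, inner_add_right, inner_smul_right, inner_sum, hinnD,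
      hinnX] at hzero
    have h2 : ((-(α * ∑ i, ‖J (D i h)‖ ^ 2) + β * ∑ i, ‖J (X i h)‖ ^ 2 : ℝ) : ℂ) = 0 := by
      push_cast
      simpa using hzero
    exact_mod_cast h2
  linarith

/-- For an eigenvector of `-α ∑ D_i² + β ∑ X_i²`, the vector `∑ X_i² h` is controlled by the
eigenvalue. -/
lemma norm_sum_sq_le_of_eigen
    (hX : ∀ i f g, inner ℂ (J (X i f)) (J g) = inner ℂ (J f) (J (X i g)))
    (hD : ∀ i f g, inner ℂ (J (D i f)) (J g) = -inner ℂ (J f) (J (D i g)))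
    (hDX : ∀ i j f, D i (X j f) = X j (D i f) + if i = j then f else 0)
    {α β μ : ℝ} (hα : 0 ≤ α) (hβ : 0 ≤ β) {h : S}
    (heig : -(α : ℂ) • ∑ i, D i (D i h) + (β : ℂ) • ∑ i, X i (X i h) = (μ : ℂ) • h) :
    β ^ 2 * ‖J (∑ i, X i (X i h))‖ ^ 2 ≤
      (μ ^ 2 + 2 * α * β * Fintype.card ι) * ‖J h‖ ^ 2 := by
  -- Moving `D i` across the inner product and commuting it past `X i` returns the same real part
  -- with opposite sign, plus `‖J h‖²`.
  have hre : ∀ i, (inner ℂ (J (D i h)) (J (X i h))).re = -(‖J h‖ ^ 2 / 2) := by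
    intro i
    have h1 : inner ℂ (J (D i h)) (J (X i h)) =
        -(inner ℂ (J (X i h)) (J (D i h)) + inner ℂ (J h) (J h)) := by
      rw [hD, hDX, map_add, inner_add_right, ← hX]; simp
    have h2 := congrArg Complex.re h1
    rw [← inner_conj_symm (J (X i h)), Complex.neg_re, Complex.add_re, Complex.conj_re,
      inner_self_eq_norm_sq_to_K] at h2
    have h3 : (((‖J h‖ : ℝ) : ℂ) ^ 2).re = ‖J h‖ ^ 2 := by norm_cast
    simp only [Complex.coe_algebraMap] at h2
    linarith
  have hij : ∀ i j, (inner ℂ (J (D i (D i h))) (J (X j (X j h)))).re =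
      -‖J (X j (D i h))‖ ^ 2 + if i = j then ‖J h‖ ^ 2 else 0 := by
    intro i j
    have h0 : D i (X j (X j h)) = X j (X j (D i h)) + if i = j then (2 : ℂ) • X j h else 0 := by
      rw [hDX, hDX, map_add]
      split_ifs
      · rw [two_smul]; abel
      · simp
    rw [hD, h0, map_add, inner_add_right, ← hX, inner_self_eq_norm_sq_to_K, Complex.neg_re,
      Complex.add_re]
    have h3 : (((‖J (X j (D i h))‖ : ℝ) : ℂ) ^ 2).re = ‖J (X j (D i h))‖ ^ 2 := by norm_cast
    simp only [Complex.coe_algebraMap, h3]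
    split_ifs with hij
    · subst hij
      rw [map_smul, inner_smul_right, ← Complex.ofReal_ofNat, Complex.re_ofReal_mul, hre]
      ring
    · simp
  -- The terms `-‖J (X j (D i h))‖²` have the good sign; only the commutators with `i = j`
  -- contribute. The claim follows by expanding the squared norm of the eigenvalue equation.
  have hcross : (inner ℂ (J (∑ i, D i (D i h))) (J (∑ i, X i (X i h)))).re ≤
      Fintype.card ι * ‖J h‖ ^ 2 := by
    simp only [map_sum, inner_sum, sum_inner, Complex.re_sum, hij, Finset.sum_add_distrib,
      Finset.sum_ite_eq', Finset.mem_univ, if_true, Finset.sum_const, Finset.card_univ,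
      nsmul_eq_mul]
    have : ∑ i, ∑ j, -‖J (X i (D j h))‖ ^ 2 ≤ 0 :=
      Finset.sum_nonpos fun i _ => Finset.sum_nonpos fun j _ => by simp
    linarith
  have hnorm := congrArg (fun f => ‖J f‖ ^ 2) heig
  simp only [map_add, map_smul] at hnorm
  rw [@norm_add_sq ℂ, inner_smul_left, inner_smul_right, norm_smul, norm_smul, norm_smul, norm_neg,
    Complex.norm_real, Complex.norm_real, Complex.norm_real, mul_pow, mul_pow, mul_pow,
    Real.norm_eq_abs, Real.norm_eq_abs, Real.norm_eq_abs, sq_abs, sq_abs, sq_abs, map_neg,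
    Complex.conj_ofReal] at hnorm
  have hr : RCLike.re (-(α : ℂ) * ((β : ℂ) *
      inner ℂ (J (∑ i, D i (D i h))) (J (∑ i, X i (X i h))))) =
      -(α * β) * (inner ℂ (J (∑ i, D i (D i h))) (J (∑ i, X i (X i h)))).re := by
    rw [← mul_assoc, ← Complex.ofReal_neg, ← Complex.ofReal_mul, neg_mul]
    exact Complex.re_ofReal_mul _ _
  rw [hr] at hnorm
  have := mul_le_mul_of_nonneg_left hcross (mul_nonneg hα hβ)
  have h5 : 0 ≤ α ^ 2 * ‖J (∑ i, D i (D i h))‖ ^ 2 := by positivity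
  linarith

end Virial

open scoped LineDeriv Laplacian FourierTransform

/-! ### Position and derivative operators on the Schwartz space -/

section CanonicalOperators

variable {d : ℕ}

/-- Multiplication by the `i`-th coordinate. -/
def position (i : Fin d) :
    𝓢(EuclideanSpace ℝ (Fin d), ℂ) →L[ℂ] 𝓢(EuclideanSpace ℝ (Fin d), ℂ) :=
  SchwartzMap.smulLeftCLM ℂ fun x => ((inner ℝ x (EuclideanSpace.basisFun (Fin d) ℝ i) : ℝ) : ℂ)

/-- The `i`-th partial derivative. -/
def partialDeriv (i : Fin d) :
    𝓢(EuclideanSpace ℝ (Fin d), ℂ) →L[ℂ] 𝓢(EuclideanSpace ℝ (Fin d), ℂ) :=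
  LineDeriv.lineDerivOpCLM ℂ 𝓢(EuclideanSpace ℝ (Fin d), ℂ) (EuclideanSpace.basisFun (Fin d) ℝ i)

variable (f g : 𝓢(EuclideanSpace ℝ (Fin d), ℂ)) (i j : Fin d)

lemma position_apply (x : EuclideanSpace ℝ (Fin d)) :
    position i f x = (x i : ℂ) * f x := by
  rw [position, SchwartzMap.smulLeftCLM_apply_apply (by fun_prop), smul_eq_mul,
    real_inner_comm, EuclideanSpace.basisFun_inner]

lemma partialDeriv_apply (x : EuclideanSpace ℝ (Fin d)) :
    partialDeriv i f x = fderiv ℝ f x (EuclideanSpace.basisFun (Fin d) ℝ i) := rfl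

lemma partialDeriv_position :
    partialDeriv i (position j f) = position j (partialDeriv i f) + if i = j then f else 0 := by
  ext x
  have h1 : (position j f : EuclideanSpace ℝ (Fin d) → ℂ) = fun x => (x j : ℂ) * f x :=
    funext (position_apply f j)
  have h2 : HasFDerivAt (fun x : EuclideanSpace ℝ (Fin d) => (x j : ℂ))
      (Complex.ofRealCLM.comp (EuclideanSpace.proj j : EuclideanSpace ℝ (Fin d) →L[ℝ] ℝ)) x :=
    (Complex.ofRealCLM.comp
      (EuclideanSpace.proj j : EuclideanSpace ℝ (Fin d) →L[ℝ] ℝ)).hasFDerivAt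
  have h3 := h2.mul (f.hasFDerivAt x)
  rw [partialDeriv_apply, h1, show fderiv ℝ (fun x => (x j : ℂ) * f x) x = _ from h3.fderiv]
  change _ = position j (partialDeriv i f) x +
    (if i = j then f else 0 : 𝓢(EuclideanSpace ℝ (Fin d), ℂ)) x
  rw [position_apply, partialDeriv_apply]
  by_cases hij : i = j
  · subst hij
    simp
  · simp [hij, Ne.symm hij]

lemma position_comm : position i (position j f) = position j (position i f) := by
  ext x
  simp only [position_apply]
  ring

lemma partialDeriv_comm : partialDeriv i (partialDeriv j f) = partialDeriv j (partialDeriv i f) := by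
  ext x
  have hc : ∀ i, (partialDeriv i f : EuclideanSpace ℝ (Fin d) → ℂ) =
      fun y => fderiv ℝ f y (EuclideanSpace.basisFun (Fin d) ℝ i) := fun i => rfl
  have h2 : ∀ v w, fderiv ℝ (fun y => fderiv ℝ f y v) x w = fderiv ℝ (fderiv ℝ f) x w v := by
    intro v w
    have hd : DifferentiableAt ℝ (fderiv ℝ f) x :=
      ((f.smooth 2).fderiv_right (m := 1) (by norm_num)).differentiable (by norm_num) x
    rw [fderiv_clm_apply hd (differentiableAt_const v)]
    simp
  rw [partialDeriv_apply, partialDeriv_apply, hc, hc, h2, h2]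
  exact second_derivative_symmetric (f := f) (f' := fderiv ℝ f) (fun y => f.hasFDerivAt y)
    ((((f.smooth 2).fderiv_right (m := 1) (by norm_num)).differentiable (by norm_num) x).hasFDerivAt)
    _ _

lemma inner_toLp_position :
    inner ℂ ((position i f).toLp 2 (volume : Measure (EuclideanSpace ℝ (Fin d)))) (g.toLp 2) =
      inner ℂ (f.toLp 2) ((position i g).toLp 2) := by
  rw [SchwartzMap.inner_toL2_toL2_eq _ _ volume, SchwartzMap.inner_toL2_toL2_eq _ _ volume]
  congr 1 with x
  simp only [position_apply, RCLike.inner_apply, map_mul, Complex.conj_ofReal]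
  ring

lemma inner_toLp_partialDeriv :
    inner ℂ ((partialDeriv i f).toLp 2 (volume : Measure (EuclideanSpace ℝ (Fin d)))) (g.toLp 2) =
      -inner ℂ (f.toLp 2) ((partialDeriv i g).toLp 2) := by
  rw [SchwartzMap.inner_toL2_toL2_eq _ _ volume, SchwartzMap.inner_toL2_toL2_eq _ _ volume]
  have := SchwartzMap.integral_bilinear_lineDerivOp_right_eq_neg_left (μ := volume) f g
    ((ContinuousLinearMap.mul ℝ ℂ).comp (Complex.conjCLE : ℂ →L[ℝ] ℂ))
    (EuclideanSpace.basisFun (Fin d) ℝ i)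
  simp only [RCLike.inner_apply]
  simp only [ContinuousLinearMap.comp_apply, ContinuousLinearMap.mul_apply',
    ContinuousLinearEquiv.coe_coe, Complex.conjCLE_apply] at this
  simp_rw [mul_comm (g _), mul_comm (partialDeriv i g _)]
  exact (neg_eq_iff_eq_neg.2 this).symm

lemma laplacian_eq_sum_partialDeriv : Δ f = ∑ i, partialDeriv i (partialDeriv i f) :=
  SchwartzMap.laplacian_eq_sum (EuclideanSpace.basisFun (Fin d) ℝ) f

lemma sum_position_position_apply (x : EuclideanSpace ℝ (Fin d)) :
    (∑ i, position i (position i f)) x = ((‖x‖ ^ 2 : ℝ) : ℂ) * f x := by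
  rw [sum_apply]
  simp only [position_apply]
  rw [EuclideanSpace.real_norm_sq_eq, Complex.ofReal_sum, Finset.sum_mul]
  refine Finset.sum_congr rfl fun i _ => ?_
  push_cast
  ring

lemma norm_toLp_sq_eq_integral :
    ‖f.toLp 2 (volume : Measure (EuclideanSpace ℝ (Fin d)))‖ ^ 2 = ∫ x, ‖f x‖ ^ 2 := by
  have h := SchwartzMap.inner_toL2_toL2_eq f f volume
  rw [inner_self_eq_norm_sq_to_K] at h
  have h2 : ∀ x, inner ℂ (f x) (f x) = ((‖f x‖ ^ 2 : ℝ) : ℂ) := by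
    intro x
    rw [inner_self_eq_norm_sq_to_K]
    norm_cast
  simp_rw [h2] at h
  rw [integral_complex_ofReal] at h
  refine Complex.ofReal_injective ?_
  rw [← h]
  norm_cast

lemma integrable_norm_sq :
    Integrable (fun x => ‖f x‖ ^ 2) (volume : Measure (EuclideanSpace ℝ (Fin d))) :=
  (f.memLp 2 volume).integrable_norm_pow (by norm_num)

end CanonicalOperators

/-! ### Weighted norms of oscillator eigenfunctions -/

section WeightedLowerBound

variable {d : ℕ}

/-- The parabola is nonpositive for `t ≤ 1/4` and never exceeds `2K`, its vertex being at `t = 4K`,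
while `t^s ≥ (1/4)^s` for `t > 1/4`. Integrated against a probability density, it turns mean `1/2`
and second moment at most `K` into a lower bound on the moment of order `s`. -/
lemma exists_const_mul_sub_sq_le_rpow {s : ℝ} (hs : 0 ≤ s) {K : ℝ} (hK : 0 < K) :
    ∃ c : ℝ, 0 < c ∧ ∀ t : ℝ, 0 ≤ t → c * (t - 1 / 4 - t ^ 2 / (8 * K)) ≤ t ^ s := by
  refine ⟨(1 / 4) ^ s / (2 * K), by positivity, fun t ht => ?_⟩
  by_cases h : t ≤ 1 / 4
  · have h1 : t - 1 / 4 - t ^ 2 / (8 * K) ≤ 0 := by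
      have : 0 ≤ t ^ 2 / (8 * K) := by positivity
      linarith
    exact (mul_nonpos_of_nonneg_of_nonpos (by positivity) h1).trans (by positivity)
  · push Not at h
    have h1 : t - 1 / 4 - t ^ 2 / (8 * K) ≤ 2 * K := by
      have h2 : t - t ^ 2 / (8 * K) ≤ 2 * K := by
        rw [sub_le_iff_le_add, ← sub_le_iff_le_add', le_div_iff₀ (by positivity)]
        nlinarith [sq_nonneg (t - 4 * K)]
      linarith
    calc (1 / 4) ^ s / (2 * K) * (t - 1 / 4 - t ^ 2 / (8 * K))
        ≤ (1 / 4) ^ s / (2 * K) * (2 * K) := by gcongr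
      _ = (1 / 4) ^ s := by field_simp
      _ ≤ t ^ s := by gcongr

variable (ψ : 𝓢(EuclideanSpace ℝ (Fin d), ℂ))

lemma sum_norm_toLp_position_sq :
    ∑ i, ‖(position i ψ).toLp 2 (volume : Measure (EuclideanSpace ℝ (Fin d)))‖ ^ 2 =
      ∫ x, ‖x‖ ^ 2 * ‖ψ x‖ ^ 2 := by
  simp_rw [norm_toLp_sq_eq_integral]
  rw [← integral_finsetSum _ (fun i _ => integrable_norm_sq _)]
  congr 1 with x
  simp_rw [position_apply, norm_mul, mul_pow, ← Finset.sum_mul]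
  rw [EuclideanSpace.real_norm_sq_eq]
  simp

lemma norm_toLp_sum_position_position_sq :
    ‖(∑ i, position i (position i ψ)).toLp 2
      (volume : Measure (EuclideanSpace ℝ (Fin d)))‖ ^ 2 = ∫ x, (‖x‖ ^ 2) ^ 2 * ‖ψ x‖ ^ 2 := by
  rw [norm_toLp_sq_eq_integral]
  congr 1 with x
  rw [sum_position_position_apply, norm_mul, mul_pow, Complex.norm_real, norm_pow, norm_norm]

lemma integrable_norm_sq_mul_norm_sq :
    Integrable (fun x : EuclideanSpace ℝ (Fin d) => ‖x‖ ^ 2 * ‖ψ x‖ ^ 2) := by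
  refine (integrable_finsetSum Finset.univ
    (fun i _ => integrable_norm_sq (position i ψ))).congr (ae_of_all _ fun x => ?_)
  simp_rw [position_apply, norm_mul, mul_pow, ← Finset.sum_mul]
  rw [EuclideanSpace.real_norm_sq_eq]
  simp

lemma integrable_norm_pow_four_mul_norm_sq :
    Integrable (fun x : EuclideanSpace ℝ (Fin d) => (‖x‖ ^ 2) ^ 2 * ‖ψ x‖ ^ 2) := by
  refine (integrable_norm_sq (∑ i, position i (position i ψ))).congr (ae_of_all _ fun x => ?_)
  simp only
  rw [sum_position_position_apply, norm_mul, mul_pow, Complex.norm_real, norm_pow, norm_norm]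

/-- `SchwartzMap.toLp` as a linear map into `L²`. -/
def toL2 (d : ℕ) : 𝓢(EuclideanSpace ℝ (Fin d), ℂ) →ₗ[ℂ]
    Lp ℂ 2 (volume : Measure (EuclideanSpace ℝ (Fin d))) :=
  (SchwartzMap.toLpCLM ℂ ℂ 2 (volume : Measure (EuclideanSpace ℝ (Fin d)))).toLinearMap

variable {ψ} {α β μ : ℝ}

lemma eigen_eq_sum
    (heq : ∀ x, -(α : ℂ) * Δ ψ x + (β : ℂ) * (((‖x‖ ^ 2 : ℝ) : ℂ) * ψ x) = (μ : ℂ) * ψ x) :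
    -(α : ℂ) • ∑ i, partialDeriv i (partialDeriv i ψ) +
      (β : ℂ) • ∑ i, position i (position i ψ) = (μ : ℂ) • ψ := by
  ext x
  have := heq x
  rw [laplacian_eq_sum_partialDeriv, ← sum_position_position_apply] at this
  exact this

lemma mul_integral_norm_sq_mul_norm_sq_of_eigen
    (heq : ∀ x, -(α : ℂ) * Δ ψ x + (β : ℂ) * (((‖x‖ ^ 2 : ℝ) : ℂ) * ψ x) = (μ : ℂ) * ψ x) :
    β * ∫ x, ‖x‖ ^ 2 * ‖ψ x‖ ^ 2 =
      μ / 2 * ‖ψ.toLp 2 (volume : Measure (EuclideanSpace ℝ (Fin d)))‖ ^ 2 := by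
  rw [← sum_norm_toLp_position_sq]
  exact virial_identity (J := toL2 d) (ι := Fin d)
    (X := fun i => (position i).toLinearMap) (D := fun i => (partialDeriv i).toLinearMap)
    (fun i f g => inner_toLp_position f g i) (fun i f g => inner_toLp_partialDeriv f g i)
    (fun i j f => position_comm f i j) (fun i j f => partialDeriv_comm f i j)
    (fun i j f => partialDeriv_position f i j) (eigen_eq_sum heq)

lemma mul_integral_norm_pow_four_mul_norm_sq_le_of_eigen (hα : 0 ≤ α) (hβ : 0 ≤ β)
    (heq : ∀ x, -(α : ℂ) * Δ ψ x + (β : ℂ) * (((‖x‖ ^ 2 : ℝ) : ℂ) * ψ x) = (μ : ℂ) * ψ x) :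
    β ^ 2 * ∫ x, (‖x‖ ^ 2) ^ 2 * ‖ψ x‖ ^ 2 ≤ (μ ^ 2 + 2 * α * β * d) *
      ‖ψ.toLp 2 (volume : Measure (EuclideanSpace ℝ (Fin d)))‖ ^ 2 := by
  rw [← norm_toLp_sum_position_position_sq]
  have := norm_sum_sq_le_of_eigen (J := toL2 d) (ι := Fin d)
    (X := fun i => (position i).toLinearMap) (D := fun i => (partialDeriv i).toLinearMap)
    (fun i f g => inner_toLp_position f g i) (fun i f g => inner_toLp_partialDeriv f g i)
    (fun i j f => partialDeriv_position f i j) hα hβ (eigen_eq_sum heq)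
  rwa [Fintype.card_fin] at this

/-- An eigenfunction of `-α Δ + β |x|²` with eigenvalue `μ` has a weighted norm at least of the
order suggested by its oscillation region `{β |x|² ≤ μ}`. -/
lemma exists_lower_bound_weighted_norm (d : ℕ) {s α β μ₀ : ℝ} (hs : 0 ≤ s) (hα : 0 < α)
    (hβ : 0 < β) (hμ₀ : 0 < μ₀) :
    ∃ c : ℝ, 0 < c ∧ ∀ (ψ : 𝓢(EuclideanSpace ℝ (Fin d), ℂ)) (μ : ℝ), μ₀ ≤ μ →
      (∀ x, -(α : ℂ) * Δ ψ x + (β : ℂ) * (((‖x‖ ^ 2 : ℝ) : ℂ) * ψ x) = (μ : ℂ) * ψ x) →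
      c * μ ^ s * ‖ψ.toLp 2 (volume : Measure (EuclideanSpace ℝ (Fin d)))‖ ^ 2 ≤
        ‖(SchwartzMap.smulLeftCLM ℂ (japaneseBracketPow d s) ψ).toLp 2
          (volume : Measure (EuclideanSpace ℝ (Fin d)))‖ ^ 2 := by
  -- Chosen so that `μ² + 2αβd ≤ K μ²` for all `μ ≥ μ₀`: `K` bounds the second moment of `t = β |x|²
  -- / μ`.
  set K : ℝ := 1 + 2 * α * β * d / μ₀ ^ 2 with hK
  have hKpos : 0 < K := by positivity
  obtain ⟨c, hc, hcle⟩ := exists_const_mul_sub_sq_le_rpow hs hKpos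
  -- The `1/8` is `1/2 - 1/4 - 1/8`: the mean of `t`, minus the constant, minus the bound on the
  -- quadratic term.
  refine ⟨c / 8 * (1 / β) ^ s, by positivity, fun ψ μ hμ heq => ?_⟩
  have hμpos : 0 < μ := hμ₀.trans_le hμ
  have hi2 := integrable_norm_sq_mul_norm_sq ψ
  have hi4 := integrable_norm_pow_four_mul_norm_sq ψ
  have hi0 := integrable_norm_sq ψ
  have hvir := mul_integral_norm_sq_mul_norm_sq_of_eigen heq
  have hfour := mul_integral_norm_pow_four_mul_norm_sq_le_of_eigen hα.le hβ.le heq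
  rw [norm_toLp_sq_eq_integral (SchwartzMap.smulLeftCLM _ _ _)]
  set N := ‖ψ.toLp 2 (volume : Measure (EuclideanSpace ℝ (Fin d)))‖ ^ 2 with hN
  have hN0 : ∫ x, ‖ψ x‖ ^ 2 = N := (norm_toLp_sq_eq_integral ψ).symm
  have hNnn : 0 ≤ N := by positivity
  have hpt : ∀ x, (μ / β) ^ s * c * (β / μ * (‖x‖ ^ 2 * ‖ψ x‖ ^ 2) - 1 / 4 * ‖ψ x‖ ^ 2 -
      (β / μ) ^ 2 / (8 * K) * ((‖x‖ ^ 2) ^ 2 * ‖ψ x‖ ^ 2)) ≤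
      ‖SchwartzMap.smulLeftCLM ℂ (japaneseBracketPow d s) ψ x‖ ^ 2 := by
    intro x
    rw [SchwartzMap.smulLeftCLM_apply_apply (japaneseBracketPow_hasTemperateGrowth d s),
      norm_smul, mul_pow, japaneseBracketPow, Complex.norm_real, Real.norm_eq_abs, sq_abs]
    have h1 : ((1 + ‖x‖ ^ 2) ^ (s / 2)) ^ 2 = (1 + ‖x‖ ^ 2) ^ s := by
      rw [← Real.rpow_natCast, ← Real.rpow_mul (by positivity)]
      congr 1
      push_cast
      ring
    have h2 := hcle (β / μ * ‖x‖ ^ 2) (by positivity)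
    have h3 : (μ / β) ^ s * (β / μ * ‖x‖ ^ 2) ^ s ≤ (1 + ‖x‖ ^ 2) ^ s := by
      rw [← Real.mul_rpow (by positivity) (by positivity)]
      have : μ / β * (β / μ * ‖x‖ ^ 2) = ‖x‖ ^ 2 := by field_simp
      rw [this]
      refine Real.rpow_le_rpow (by positivity) (by linarith) hs
    rw [h1]
    calc _ = (μ / β) ^ s * (c * (β / μ * ‖x‖ ^ 2 - 1 / 4 - (β / μ * ‖x‖ ^ 2) ^ 2 / (8 * K))) *
          ‖ψ x‖ ^ 2 := by ring
      _ ≤ (μ / β) ^ s * (β / μ * ‖x‖ ^ 2) ^ s * ‖ψ x‖ ^ 2 := by gcongr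
      _ ≤ _ := by gcongr
  refine le_trans ?_ (integral_mono ((((hi2.const_mul _).sub (hi0.const_mul _)).sub
    (hi4.const_mul _)).const_mul _) (integrable_norm_sq _) hpt)
  rw [integral_const_mul, integral_sub' ((hi2.const_mul _).sub (hi0.const_mul _)) (hi4.const_mul _),
    integral_sub' (hi2.const_mul _) (hi0.const_mul _), integral_const_mul, integral_const_mul,
    integral_const_mul, hN0]
  have e2 : β / μ * ∫ x, ‖x‖ ^ 2 * ‖ψ x‖ ^ 2 = N / 2 := by
    rw [div_mul_eq_mul_div, hvir]
    field_simp
  have e4 : (β / μ) ^ 2 / (8 * K) * ∫ x, (‖x‖ ^ 2) ^ 2 * ‖ψ x‖ ^ 2 ≤ N / 8 := by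
    have h1 : μ ^ 2 + 2 * α * β * d ≤ μ ^ 2 * K := by
      have : 2 * α * β * d ≤ μ ^ 2 * (2 * α * β * d / μ₀ ^ 2) := by
        rw [mul_div_assoc', le_div_iff₀ (by positivity), mul_comm (μ ^ 2)]
        gcongr
      rw [hK, mul_add]
      linarith
    have h2 := hfour.trans (mul_le_mul_of_nonneg_right h1 hNnn)
    calc _ = β ^ 2 * (∫ x, (‖x‖ ^ 2) ^ 2 * ‖ψ x‖ ^ 2) / (μ ^ 2 * (8 * K)) := by
          field_simp
      _ ≤ μ ^ 2 * K * N / (μ ^ 2 * (8 * K)) := by gcongr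
      _ = N / 8 := by field_simp
  have e0 : (1 / β) ^ s * μ ^ s = (μ / β) ^ s := by
    rw [← Real.mul_rpow (by positivity) (by positivity)]
    congr 1
    ring
  rw [e2]
  calc c / 8 * (1 / β) ^ s * μ ^ s * N = (μ / β) ^ s * c * (N / 2 - 1 / 4 * N - N / 8) := by
        rw [← e0]; ring
    _ ≤ _ := by gcongr

/-- The Fourier transform turns the harmonic oscillator into `4π²|ξ|² - Δ / 4π²`. -/
lemma fourier_eigen {h : 𝓢(EuclideanSpace ℝ (Fin d), ℂ)} {μ : ℝ}
    (heq : ∀ x, harmonicOscillator h x = (μ : ℂ) * h x) (ξ : EuclideanSpace ℝ (Fin d)) :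
    -(((4 * Real.pi ^ 2)⁻¹ : ℝ) : ℂ) * Δ (𝓕 h) ξ +
      ((4 * Real.pi ^ 2 : ℝ) : ℂ) * (((‖ξ‖ ^ 2 : ℝ) : ℂ) * 𝓕 h ξ) = (μ : ℂ) * 𝓕 h ξ := by
  have h0 : -Δ h + ∑ i, position i (position i h) = (μ : ℂ) • h := by
    ext x
    have := heq x
    rw [harmonicOscillator, ← sum_position_position_apply] at this
    exact this
  have hpos : ∀ i (f : 𝓢(EuclideanSpace ℝ (Fin d), ℂ)), SchwartzMap.smulLeftCLM ℂ
      (inner ℝ · (EuclideanSpace.basisFun (Fin d) ℝ i)) f = position i f := fun i f =>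
    (SchwartzMap.smulLeftCLM_ofReal ℂ (by fun_prop) f).symm
  have hpd : ∀ i (f : 𝓢(EuclideanSpace ℝ (Fin d), ℂ)),
      ∂_{EuclideanSpace.basisFun (Fin d) ℝ i} f = partialDeriv i f := fun _ _ => rfl
  -- The transform has kernel `exp(-2πi x·ξ)`, which produces the factors `4π²` and `1 / 4π²`.
  have hF1 : ∀ i (f : 𝓢(EuclideanSpace ℝ (Fin d), ℂ)),
      𝓕 (partialDeriv i f) = (2 * Real.pi * Complex.I) • position i (𝓕 f) := by
    intro i f
    rw [← hpd, SchwartzMap.fourier_lineDerivOp_eq, hpos]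
  have hF2 : ∀ i (f : 𝓢(EuclideanSpace ℝ (Fin d), ℂ)),
      𝓕 (position i f) = -(2 * Real.pi * Complex.I)⁻¹ • partialDeriv i (𝓕 f) := by
    intro i f
    have h2 : 2 * (Real.pi : ℂ) * Complex.I ≠ 0 := Complex.two_pi_I_ne_zero
    rw [← hpd, SchwartzMap.lineDerivOp_fourier_eq, hpos, FourierTransform.fourier_smul, smul_smul,
      neg_mul_neg, inv_mul_cancel₀ h2, one_smul]
  have h1 := congrArg (FourierTransform.fourierCLM ℂ 𝓢(EuclideanSpace ℝ (Fin d), ℂ)) h0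
  rw [laplacian_eq_sum_partialDeriv] at h1
  simp only [map_add, map_neg, map_sum, map_smul, FourierTransform.fourierCLM_apply, hF1, hF2,
    smul_smul] at h1
  rw [← Finset.smul_sum, ← Finset.smul_sum, ← laplacian_eq_sum_partialDeriv] at h1
  have h3 := DFunLike.congr_fun h1 ξ
  have h4 : -((2 * Real.pi * Complex.I * (2 * Real.pi * Complex.I)) *
      (∑ i, position i (position i (𝓕 h))) ξ) +
      -(2 * Real.pi * Complex.I)⁻¹ * -(2 * Real.pi * Complex.I)⁻¹ * Δ (𝓕 h) ξ =
      (μ : ℂ) * 𝓕 h ξ := h3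
  rw [sum_position_position_apply] at h4
  rw [← h4]
  have h5 : 2 * Real.pi * Complex.I * (2 * Real.pi * Complex.I) = -(4 * (Real.pi : ℂ) ^ 2) := by
    linear_combination (4 * (Real.pi : ℂ) ^ 2) * Complex.I_sq
  rw [neg_mul_neg, ← mul_inv, h5]
  push_cast
  rw [inv_neg]
  ring

end WeightedLowerBound

/-! ### Lower bounds for the basis functions in both norms -/

section LowerBounds

variable {d : ℕ} (b : HermiteBasis d)

lemma norm_toLp_hermite (n : ℕ) :
    ‖(b.h n).toLp 2 (volume : Measure (EuclideanSpace ℝ (Fin d)))‖ = 1 := b.orthonormal.1 n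

lemma freq_sq_rpow (n : ℕ) (s : ℝ) : (b.freq n ^ 2) ^ s = b.freq n ^ (2 * s) := by
  rw [← Real.rpow_natCast, ← Real.rpow_mul (b.freq_pos n).le]
  norm_num

lemma freq_zero_sq_le (n : ℕ) : b.freq 0 ^ 2 ≤ b.freq n ^ 2 :=
  pow_le_pow_left₀ (b.freq_pos 0).le (b.freq_mono (Nat.zero_le n)) 2

lemma exists_lower_bound_bracket {s : ℝ} (hs : 0 ≤ s) :
    ∃ c : ℝ, 0 < c ∧ ∀ n, c * b.freq n ^ (2 * s) ≤
      ‖(SchwartzMap.smulLeftCLM ℂ (japaneseBracketPow d s) (b.h n)).toLp 2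
        (volume : Measure (EuclideanSpace ℝ (Fin d)))‖ ^ 2 := by
  obtain ⟨c, hc, h⟩ := exists_lower_bound_weighted_norm d hs one_pos one_pos
    (pow_pos (b.freq_pos 0) 2)
  refine ⟨c, hc, fun n => ?_⟩
  have := h (b.h n) (b.freq n ^ 2) (freq_zero_sq_le b n) fun x => by
    rw [← b.eigen n x, harmonicOscillator]
    simp
  rwa [norm_toLp_hermite, one_pow, mul_one, freq_sq_rpow] at this

/-- By Plancherel the Bessel norm of `h_n` is the weighted norm of its Fourier transform, an
eigenfunction with `α = 1 / 4π²`, `β = 4π²` and the same eigenvalue. -/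
lemma exists_lower_bound_bessel {s : ℝ} (hs : 0 ≤ s) :
    ∃ c : ℝ, 0 < c ∧ ∀ n, c * b.freq n ^ (2 * s) ≤
      ‖(SchwartzMap.fourierMultiplierCLM ℂ (japaneseBracketPow d s) (b.h n)).toLp 2
        (volume : Measure (EuclideanSpace ℝ (Fin d)))‖ ^ 2 := by
  have hπ := Real.pi_pos
  obtain ⟨c, hc, h⟩ := exists_lower_bound_weighted_norm d hs
    (show (0 : ℝ) < (4 * Real.pi ^ 2)⁻¹ by positivity)
    (show (0 : ℝ) < 4 * Real.pi ^ 2 by positivity) (pow_pos (b.freq_pos 0) 2)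
  refine ⟨c, hc, fun n => ?_⟩
  have := h (𝓕 (b.h n)) (b.freq n ^ 2) (freq_zero_sq_le b n) (fourier_eigen (b.eigen n))
  rw [SchwartzMap.norm_fourier_toL2_eq, norm_toLp_hermite, one_pow, mul_one, freq_sq_rpow] at this
  rwa [← SchwartzMap.norm_fourier_toL2_eq, SchwartzMap.fourierMultiplierCLM_apply,
    FourierTransform.fourier_fourierInv_eq]

end LowerBounds

/-! ### Hermite expansions of tempered distributions -/

section Expansions

variable {d : ℕ} (b : HermiteBasis d)

/-- The Hilbert basis of `L²` given by the eigenfunctions. -/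
def hilbertBasis : HilbertBasis ℕ ℂ (Lp ℂ 2 (volume : Measure (EuclideanSpace ℝ (Fin d)))) :=
  HilbertBasis.mk b.orthonormal b.complete.ge

lemma hilbertBasis_apply (n : ℕ) : hilbertBasis b n = (b.h n).toLp 2 := by
  simp [hilbertBasis]

lemma toTemperedDistribution_hilbertBasis (n : ℕ) :
    Lp.toTemperedDistributionCLM ℂ volume 2 (hilbertBasis b n) = basisDist b n := by
  rw [hilbertBasis_apply]
  exact Lp.toTemperedDistribution_toLp_eq (b.h n)

lemma coeff_toTemperedDistribution
    (f : Lp ℂ 2 (volume : Measure (EuclideanSpace ℝ (Fin d)))) (n : ℕ) :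
    coeff b (Lp.toTemperedDistribution f) n = inner ℂ (hilbertBasis b n) f := by
  rw [coeff, Lp.toTemperedDistribution_apply, hilbertBasis_apply, L2.inner_def]
  refine integral_congr_ae ?_
  filter_upwards [(b.h n).coeFn_toLp 2 volume] with x hx
  rw [hx, RCLike.inner_apply, smul_eq_mul, mul_comm]
  rfl

lemma coeff_schwartz (φ : 𝓢(EuclideanSpace ℝ (Fin d), ℂ)) (n : ℕ) :
    coeff b (SchwartzMap.toTemperedDistributionCLM (EuclideanSpace ℝ (Fin d)) ℂ volume φ) n =
      inner ℂ (hilbertBasis b n) (φ.toLp 2) := by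
  rw [← coeff_toTemperedDistribution, Lp.toTemperedDistribution_toLp_eq]

/-- The coefficient along `h_n` as a continuous functional. -/
def coeffCLM (n : ℕ) : 𝓢'(EuclideanSpace ℝ (Fin d), ℂ) →L[ℂ] ℂ :=
  PointwiseConvergenceCLM.evalCLM (RingHom.id ℂ) ℂ
    (SchwartzMap.postcompCLM (𝕜 := ℝ) (Complex.conjCLE : ℂ →L[ℝ] ℂ) (b.h n))

lemma coeffCLM_apply (n : ℕ) (u : 𝓢'(EuclideanSpace ℝ (Fin d), ℂ)) :
    coeffCLM b n u = coeff b u n := rfl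

lemma coeff_basisDist (m n : ℕ) : coeff b (basisDist b m) n = if n = m then 1 else 0 := by
  rw [basisDist, coeff_schwartz, ← hilbertBasis_apply]
  exact orthonormal_iff_ite.1 (hilbertBasis b).orthonormal n m

/-- The harmonic oscillator as an operator on the Schwartz space. -/
def harmonicCLM (d : ℕ) :
    𝓢(EuclideanSpace ℝ (Fin d), ℂ) →L[ℂ] 𝓢(EuclideanSpace ℝ (Fin d), ℂ) :=
  -∑ i : Fin d, partialDeriv i ∘L partialDeriv i + ∑ i : Fin d, position i ∘L position i

lemma harmonicCLM_apply_apply (φ : 𝓢(EuclideanSpace ℝ (Fin d), ℂ))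
    (x : EuclideanSpace ℝ (Fin d)) : harmonicCLM d φ x = harmonicOscillator φ x := by
  have h : harmonicCLM d φ = -Δ φ + ∑ i, position i (position i φ) := by
    rw [laplacian_eq_sum_partialDeriv]
    simp [harmonicCLM, sum_apply]
  rw [h, harmonicOscillator, ← sum_position_position_apply]
  rfl

/-- The harmonic oscillator on tempered distributions. -/
def harmonicDistCLM (d : ℕ) :
    𝓢'(EuclideanSpace ℝ (Fin d), ℂ) →L[ℂ] 𝓢'(EuclideanSpace ℝ (Fin d), ℂ) :=
  PointwiseConvergenceCLM.precomp ℂ (harmonicCLM d)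

/-- The operator on distributions is a transpose, and `H` is symmetric for the bilinear pairing `∫ φ
h_n`, without conjugation. -/
lemma harmonicDistCLM_basisDist (n : ℕ) :
    harmonicDistCLM d (basisDist b n) = ((b.freq n ^ 2 : ℝ) : ℂ) • basisDist b n := by
  ext φ
  have h1 : harmonicDistCLM d (basisDist b n) φ = basisDist b n (harmonicCLM d φ) := rfl
  have h2 : (((b.freq n ^ 2 : ℝ) : ℂ) • basisDist b n) φ =
    ((b.freq n ^ 2 : ℝ) : ℂ) * basisDist b n φ := rfl
  rw [h1, h2, basisDist, SchwartzMap.toTemperedDistributionCLM_apply_apply volume,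
    SchwartzMap.toTemperedDistributionCLM_apply_apply volume, ← integral_const_mul]
  have h3 : ∀ x, ((b.freq n ^ 2 : ℝ) : ℂ) * (φ x • b.h n x) = φ x * (-Δ (b.h n) x) +
      φ x * ((∑ i, position i (position i (b.h n))) x) := by
    intro x
    rw [smul_eq_mul, mul_left_comm, ← b.eigen n x, harmonicOscillator,
      ← sum_position_position_apply, mul_add]
  have h4 : ∀ x, harmonicCLM d φ x • b.h n x = (-Δ φ x) * b.h n x +
      φ x * ((∑ i, position i (position i (b.h n))) x) := by
    intro x
    rw [harmonicCLM_apply_apply, harmonicOscillator, sum_position_position_apply, smul_eq_mul]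
    ring
  have hint : ∀ f g : 𝓢(EuclideanSpace ℝ (Fin d), ℂ), Integrable fun x => f x * g x := fun f g =>
    (SchwartzMap.pairing (ContinuousLinearMap.mul ℂ ℂ) f g).integrable
  simp_rw [h3, h4]
  have hA : Integrable fun x => -Δ φ x * b.h n x := hint (-Δ φ) _
  have hB : Integrable fun x => φ x * -Δ (b.h n) x := hint φ (-Δ (b.h n))
  rw [integral_add hA (hint φ _), integral_add hB (hint φ _)]
  congr 1
  simp only [neg_mul, mul_neg, integral_neg]
  rw [SchwartzMap.integral_mul_laplacian_right_eq_left]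

lemma harmonicDistCLM_pow_basisDist (m n : ℕ) :
    (harmonicDistCLM d ^ m) (basisDist b n) =
      ((b.freq n ^ (2 * m) : ℝ) : ℂ) • basisDist b n := by
  induction m with
  | zero => simp
  | succ m ih =>
    rw [pow_succ', mul_apply_eq_comp, ih, map_smul, harmonicDistCLM_basisDist,
      smul_smul]
    congr 1
    push_cast
    ring

/-- The `L²` expansion is pushed through continuous maps. This yields unconditional convergence for
coefficients growing like powers of `λ_n`, with no estimate on Schwartz seminorms of `h_n`. -/
lemma hasSum_harmonicDistCLM_pow (m : ℕ) (F : lp (fun _ : ℕ => ℂ) 2) :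
    HasSum (fun n => (F n * ((b.freq n ^ (2 * m) : ℝ) : ℂ)) • basisDist b n)
      ((harmonicDistCLM d ^ m) (Lp.toTemperedDistributionCLM ℂ volume 2
        ((hilbertBasis b).repr.symm F))) := by
  have := (((hilbertBasis b).hasSum_repr_symm F).mapL
    (Lp.toTemperedDistributionCLM ℂ volume 2)).mapL (harmonicDistCLM d ^ m)
  refine this.congr_fun ?_
  intro n
  rw [map_smul, map_smul, toTemperedDistribution_hilbertBasis, harmonicDistCLM_pow_basisDist,
    smul_smul]

lemma hasSum_coeff_smul_basisDist_of_schwartz (φ : 𝓢(EuclideanSpace ℝ (Fin d), ℂ)) :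
    HasSum (fun n => coeff b
      (SchwartzMap.toTemperedDistributionCLM (EuclideanSpace ℝ (Fin d)) ℂ volume φ) n •
        basisDist b n)
      (SchwartzMap.toTemperedDistributionCLM (EuclideanSpace ℝ (Fin d)) ℂ volume φ) := by
  have := ((hilbertBasis b).hasSum_repr (φ.toLp 2)).mapL (Lp.toTemperedDistributionCLM ℂ volume 2)
  rw [Lp.toTemperedDistributionCLM_apply, Lp.toTemperedDistribution_toLp_eq] at this
  refine this.congr_fun ?_
  intro n
  rw [map_smul, toTemperedDistribution_hilbertBasis, coeff_schwartz, HilbertBasis.repr_apply_apply]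

lemma coeff_eq_of_hasSum {a : ℕ → ℂ} {u : 𝓢'(EuclideanSpace ℝ (Fin d), ℂ)}
    (h : HasSum (fun n => a n • basisDist b n) u) (n : ℕ) : coeff b u n = a n := by
  have h1 := h.mapL (coeffCLM b n)
  have h2 : HasSum (fun m => coeffCLM b n (a m • basisDist b m)) (a n) := by
    have h3 : ∀ m, coeffCLM b n (a m • basisDist b m) = if m = n then a n else 0 := by
      intro m
      rw [map_smul, coeffCLM_apply, coeff_basisDist]
      by_cases hmn : m = n
      · simp [hmn]
      · simp [hmn, Ne.symm hmn]
    simp_rw [h3]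
    exact hasSum_ite_eq n (a n)
  exact h1.unique h2

lemma sum_le_of_harmonicNorm_lt {s : ℝ} {φ : 𝓢(EuclideanSpace ℝ (Fin d), ℂ)} {ε : ℝ} (hε : 0 ≤ ε)
    (h : harmonicNorm b s φ < ENNReal.ofReal ε) (A : Finset ℕ) :
    ∑ n ∈ A, (b.freq n ^ s * ‖coeff b
      (SchwartzMap.toTemperedDistributionCLM (EuclideanSpace ℝ (Fin d)) ℂ volume φ) n‖) ^ 2 ≤
      ε ^ 2 := by
  rw [harmonicNorm] at h
  have h1 := ENNReal.rpow_lt_rpow h (show (0 : ℝ) < 2 by norm_num)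
  rw [← ENNReal.rpow_mul] at h1
  norm_num at h1
  have h2 := ((ENNReal.sum_le_tsum A).trans h1.le)
  rw [← ENNReal.ofReal_pow hε] at h2
  refine (ENNReal.ofReal_le_ofReal_iff (by positivity)).1 (le_trans (le_of_eq ?_) h2)
  rw [ENNReal.ofReal_sum_of_nonneg (fun _ _ => by positivity)]
  refine Finset.sum_congr rfl fun n _ => ?_
  rw [ENNReal.ofReal_pow (by have := b.freq_pos n; positivity),
    ENNReal.ofReal_mul (by have := b.freq_pos n; positivity), ofReal_norm]

/-- Compares the `ℓ²` norm of `H^{-m} φ` with the `𝓗^σ` norm; the constant involves `λ_0` because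
the frequencies are only known to be at least `λ_0`. -/
lemma inv_freq_pow_le (m n : ℕ) {σ : ℝ} (hm : 0 ≤ 2 * m + σ) :
    (b.freq n ^ (2 * m))⁻¹ ≤ b.freq 0 ^ (-(2 * m + σ)) * b.freq n ^ σ := by
  have h0 := b.freq_pos 0
  have hn := b.freq_pos n
  have h1 : (b.freq n ^ (2 * m))⁻¹ = b.freq n ^ (-(2 * m + σ)) * b.freq n ^ σ := by
    rw [← Real.rpow_add hn, ← Real.rpow_natCast, ← Real.rpow_neg hn.le]
    congr 1
    push_cast
    ring
  rw [h1]
  refine mul_le_mul_of_nonneg_right ?_ (by positivity)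
  exact Real.rpow_le_rpow_of_nonpos h0 (b.freq_mono (Nat.zero_le n)) (by linarith)

lemma memℓp_two_of_summable {a : ℕ → ℂ} (h : Summable fun n => ‖a n‖ ^ 2) : Memℓp a 2 :=
  memℓp_gen (by simpa using h)

lemma summable_norm_sq_coeff_schwartz (φ : 𝓢(EuclideanSpace ℝ (Fin d), ℂ)) :
    Summable fun n => ‖coeff b
      (SchwartzMap.toTemperedDistributionCLM (EuclideanSpace ℝ (Fin d)) ℂ volume φ) n‖ ^ 2 := by
  simp_rw [coeff_schwartz]
  exact Orthonormal.inner_products_summable (φ.toLp 2 volume) (hilbertBasis b).orthonormal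

/-- The coefficients of `H^{-m} φ`. -/
def negPowCoeff (m : ℕ) (φ : 𝓢(EuclideanSpace ℝ (Fin d), ℂ)) : lp (fun _ : ℕ => ℂ) 2 :=
  ⟨fun n => coeff b
    (SchwartzMap.toTemperedDistributionCLM (EuclideanSpace ℝ (Fin d)) ℂ volume φ) n *
      (((b.freq n ^ (2 * m))⁻¹ : ℝ) : ℂ), by
    refine memℓp_two_of_summable (Summable.of_nonneg_of_le (fun _ => by positivity) (fun n => ?_)
      ((summable_norm_sq_coeff_schwartz b φ).mul_right (((b.freq 0 ^ (2 * m))⁻¹) ^ 2)))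
    have h0 : 0 ≤ (b.freq n ^ (2 * m))⁻¹ := inv_nonneg.2 (pow_pos (b.freq_pos n) _).le
    rw [norm_mul, mul_pow, Complex.norm_real, Real.norm_of_nonneg h0]
    have : (b.freq n ^ (2 * m))⁻¹ ≤ (b.freq 0 ^ (2 * m))⁻¹ :=
      inv_anti₀ (pow_pos (b.freq_pos 0) _)
        (pow_le_pow_left₀ (b.freq_pos 0).le (b.freq_mono (Nat.zero_le n)) _)
    gcongr⟩

lemma negPowCoeff_apply (m : ℕ) (φ : 𝓢(EuclideanSpace ℝ (Fin d), ℂ)) (n : ℕ) :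
    negPowCoeff b m φ n = coeff b
      (SchwartzMap.toTemperedDistributionCLM (EuclideanSpace ℝ (Fin d)) ℂ volume φ) n *
        (((b.freq n ^ (2 * m))⁻¹ : ℝ) : ℂ) := rfl

lemma negPowCoeff_sub (m : ℕ) (φ ψ : 𝓢(EuclideanSpace ℝ (Fin d), ℂ)) :
    negPowCoeff b m (φ - ψ) = negPowCoeff b m φ - negPowCoeff b m ψ := by
  ext n
  rw [lp.coeFn_sub, Pi.sub_apply, negPowCoeff_apply, negPowCoeff_apply, negPowCoeff_apply,
    ← sub_mul, map_sub, ← coeffCLM_apply, map_sub, coeffCLM_apply, coeffCLM_apply]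

lemma harmonicDistCLM_pow_negPowCoeff (m : ℕ) (φ : 𝓢(EuclideanSpace ℝ (Fin d), ℂ)) :
    (harmonicDistCLM d ^ m) (Lp.toTemperedDistributionCLM ℂ volume 2
      ((hilbertBasis b).repr.symm (negPowCoeff b m φ))) =
      SchwartzMap.toTemperedDistributionCLM (EuclideanSpace ℝ (Fin d)) ℂ volume φ := by
  refine HasSum.unique ((hasSum_harmonicDistCLM_pow b m (negPowCoeff b m φ)).congr_fun fun n => ?_)
    (hasSum_coeff_smul_basisDist_of_schwartz b φ)
  rw [negPowCoeff_apply, mul_assoc, ← Complex.ofReal_mul,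
    inv_mul_cancel₀ (pow_pos (b.freq_pos n) _).ne', Complex.ofReal_one, mul_one]

lemma norm_negPowCoeff_le (m : ℕ) {σ : ℝ} (hm : 0 ≤ 2 * m + σ)
    {φ : 𝓢(EuclideanSpace ℝ (Fin d), ℂ)} {ε : ℝ} (hε : 0 ≤ ε)
    (h : harmonicNorm b σ φ < ENNReal.ofReal ε) :
    ‖negPowCoeff b m φ‖ ≤ b.freq 0 ^ (-(2 * m + σ)) * ε := by
  set C : ℝ := b.freq 0 ^ (-(2 * m + σ)) with hC
  have hCpos : 0 < C := Real.rpow_pos_of_pos (b.freq_pos 0) _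
  refine lp.norm_le_of_forall_sum_le (by norm_num) (by positivity) fun A => ?_
  have h1 : ∀ n, ‖negPowCoeff b m φ n‖ ^ 2 ≤ C ^ 2 * (b.freq n ^ σ * ‖coeff b
      (SchwartzMap.toTemperedDistributionCLM (EuclideanSpace ℝ (Fin d)) ℂ volume φ) n‖) ^ 2 := by
    intro n
    have h0 : 0 ≤ (b.freq n ^ (2 * m))⁻¹ := inv_nonneg.2 (pow_pos (b.freq_pos n) _).le
    rw [negPowCoeff_apply, norm_mul, Complex.norm_real, Real.norm_of_nonneg h0, ← mul_pow,
      mul_comm, ← mul_assoc]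
    refine pow_le_pow_left₀ (by positivity) ?_ 2
    exact mul_le_mul_of_nonneg_right (inv_freq_pow_le b m n hm) (norm_nonneg _)
  have h5 := Finset.sum_le_sum fun n (_ : n ∈ A) => h1 n
  rw [← Finset.mul_sum] at h5
  have h6 := h5.trans
    (mul_le_mul_of_nonneg_left (sum_le_of_harmonicNorm_lt b hε h A) (by positivity))
  rw [← mul_pow] at h6
  simpa using h6

/-- Every element of a harmonic Sobolev space is a power of the harmonic oscillator applied to an
`L²` function. -/
lemma exists_eq_harmonicDistCLM_pow {σ : ℝ} {u : 𝓢'(EuclideanSpace ℝ (Fin d), ℂ)}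
    (hu : MemHarmonicSobolev b σ u) :
    ∃ (m : ℕ) (F : lp (fun _ : ℕ => ℂ) 2), u = (harmonicDistCLM d ^ m)
      (Lp.toTemperedDistributionCLM ℂ volume 2 ((hilbertBasis b).repr.symm F)) := by
  obtain ⟨φ, hφ, hlim⟩ := hu
  obtain ⟨m, hm⟩ := exists_nat_ge (-σ)
  have hm' : 0 ≤ 2 * (m : ℝ) + σ := by
    have : (0 : ℝ) ≤ m := Nat.cast_nonneg m
    linarith
  set C : ℝ := b.freq 0 ^ (-(2 * m + σ)) with hC
  have hCpos : 0 < C := Real.rpow_pos_of_pos (b.freq_pos 0) _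
  -- Applying `H^{-m}` turns an `𝓗^σ`-Cauchy sequence into an `ℓ²`-Cauchy one. Its limit `F` is
  -- carried back by the continuous `H^m`, and uniqueness of limits identifies the result with `u`.
  have hcauchy : CauchySeq fun j => negPowCoeff b m (φ j) := by
    rw [Metric.cauchySeq_iff]
    intro ε hε
    obtain ⟨N, hN⟩ := hφ (ENNReal.ofReal (ε / (2 * C))) (ENNReal.ofReal_pos.2 (by positivity))
    refine ⟨N, fun j hj k hk => ?_⟩
    rw [dist_eq_norm, ← negPowCoeff_sub]
    refine (norm_negPowCoeff_le b m hm' (by positivity) (hN j hj k hk)).trans_lt ?_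
    have : C * (ε / (2 * C)) = ε / 2 := by field_simp
    rw [← hC, this]
    linarith
  obtain ⟨F, hF⟩ := cauchySeq_tendsto_of_complete hcauchy
  refine ⟨m, F, tendsto_nhds_unique hlim ?_⟩
  simp_rw [← harmonicDistCLM_pow_negPowCoeff b m]
  exact (((harmonicDistCLM d ^ m).continuous.comp
    (Lp.toTemperedDistributionCLM ℂ volume 2).continuous).comp
      (hilbertBasis b).repr.symm.continuous).tendsto F |>.comp hF

/-- The Hermite expansion of an element of a harmonic Sobolev space. -/
lemma MemHarmonicSobolev.hasSum_coeff {b : HermiteBasis d} {σ : ℝ}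
    {u : 𝓢'(EuclideanSpace ℝ (Fin d), ℂ)} (hu : MemHarmonicSobolev b σ u) :
    HasSum (fun n => coeff b u n • basisDist b n) u ∧ ∃ m : ℕ,
      Summable fun n => ‖coeff b u n * (((b.freq n ^ (2 * m))⁻¹ : ℝ) : ℂ)‖ ^ 2 := by
  obtain ⟨m, F, rfl⟩ := exists_eq_harmonicDistCLM_pow b hu
  have h := hasSum_harmonicDistCLM_pow b m F
  have hc := coeff_eq_of_hasSum b h
  refine ⟨h.congr_fun fun n => by rw [hc], m, ?_⟩
  have hF := (lp.memℓp F).summable (by norm_num)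
  refine hF.congr fun n => ?_
  rw [hc, mul_assoc, ← Complex.ofReal_mul, mul_inv_cancel₀ (pow_pos (b.freq_pos n) _).ne',
    Complex.ofReal_one, mul_one]
  simp

lemma summable_smul_basisDist {a : ℕ → ℂ} (m : ℕ)
    (ha : Summable fun n => ‖a n * (((b.freq n ^ (2 * m))⁻¹ : ℝ) : ℂ)‖ ^ 2) :
    Summable fun n => a n • basisDist b n := by
  let F : lp (fun _ : ℕ => ℂ) 2 := ⟨_, memℓp_two_of_summable ha⟩
  refine (hasSum_harmonicDistCLM_pow b m F).summable.congr fun n => ?_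
  have : F n = a n * (((b.freq n ^ (2 * m))⁻¹ : ℝ) : ℂ) := rfl
  rw [this, mul_assoc, ← Complex.ofReal_mul, inv_mul_cancel₀ (pow_pos (b.freq_pos n) _).ne',
    Complex.ofReal_one, mul_one]

/-- A distribution with a Hermite expansion is in `𝓗^s` as soon as its weighted coefficients are
square summable. -/
lemma memHarmonicSobolev_of_tsum_ne_top {s : ℝ} {u : 𝓢'(EuclideanSpace ℝ (Fin d), ℂ)}
    (hu : HasSum (fun n => coeff b u n • basisDist b n) u)
    (hs : ∑' n, (ENNReal.ofReal (b.freq n ^ s) * ‖coeff b u n‖ₑ) ^ 2 ≠ ∞) :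
    MemHarmonicSobolev b s u := by
  have hdist : ∀ k, SchwartzMap.toTemperedDistributionCLM (EuclideanSpace ℝ (Fin d)) ℂ volume
      (∑ n ∈ Finset.range k, coeff b u n • b.h n) =
      ∑ n ∈ Finset.range k, coeff b u n • basisDist b n := by
    intro k
    simp [map_sum, map_smul, basisDist]
  -- The approximating Schwartz functions are the partial sums of the expansion; their differences
  -- are controlled by tails of the weighted series.
  refine ⟨fun k => ∑ n ∈ Finset.range k, coeff b u n • b.h n, fun ε hε => ?_, ?_⟩
  · have hε2 : 0 < ε ^ 2 := by positivity
    obtain ⟨A, hA⟩ := ((ENNReal.tendsto_tsum_compl_atTop_zero hs).eventually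
      (gt_mem_nhds hε2)).exists
    obtain ⟨N, hN⟩ := A.exists_nat_subset_range
    refine ⟨N, fun j hj k hk => ?_⟩
    have hcoef : ∀ j n, coeff b (∑ m ∈ Finset.range j, coeff b u m • basisDist b m) n =
        if n < j then coeff b u n else 0 := by
      intro j n
      rw [← coeffCLM_apply, map_sum]
      simp only [map_smul, coeffCLM_apply, coeff_basisDist, smul_eq_mul, mul_ite, mul_one,
        mul_zero, Finset.sum_ite_eq, Finset.mem_range]
    have hle : harmonicNorm b s (∑ n ∈ Finset.range j, coeff b u n • b.h n -
        ∑ n ∈ Finset.range k, coeff b u n • b.h n) ≤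
        (∑' n : {n // n ∉ A},
          (ENNReal.ofReal (b.freq n ^ s) * ‖coeff b u n‖ₑ) ^ 2) ^ (1 / 2 : ℝ) := by
      rw [harmonicNorm]
      refine ENNReal.rpow_le_rpow ?_ (by norm_num)
      rw [show (∑' n : {n // n ∉ A}, (ENNReal.ofReal (b.freq n ^ s) * ‖coeff b u n‖ₑ) ^ 2) = _ from
        tsum_subtype {n | n ∉ A} fun n => (ENNReal.ofReal (b.freq n ^ s) * ‖coeff b u n‖ₑ) ^ 2]
      refine ENNReal.tsum_le_tsum fun n => ?_
      rw [map_sub, hdist, hdist, ← coeffCLM_apply, map_sub, coeffCLM_apply, coeffCLM_apply, hcoef,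
        hcoef]
      by_cases hn : n ∈ A
      · have hnN := Finset.mem_range.1 (hN hn)
        rw [if_pos (hnN.trans_le hj), if_pos (hnN.trans_le hk)]
        simp
      · rw [Set.indicator_of_mem (show n ∈ {n | n ∉ A} from hn)]
        gcongr
        split_ifs <;> simp
    refine hle.trans_lt ?_
    have := ENNReal.rpow_lt_rpow hA (show (0 : ℝ) < 1 / 2 by norm_num)
    rwa [← ENNReal.rpow_natCast ε, ← ENNReal.rpow_mul, Nat.cast_ofNat, mul_one_div_cancel two_ne_zero,
      ENNReal.rpow_one] at this
  · simp_rw [hdist]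
    exact hu.tendsto_sum_nat

end Expansions

/-! ### Randomised series and the failure of regularity -/

section Randomisation

variable {d : ℕ} (b : HermiteBasis d)

lemma tsum_enorm_sq_inner_hilbertBasis
    (f : Lp ℂ 2 (volume : Measure (EuclideanSpace ℝ (Fin d)))) :
    ∑' k, ‖inner ℂ (hilbertBasis b k) f‖ₑ ^ 2 = ENNReal.ofReal (‖f‖ ^ 2) := by
  have hs := Orthonormal.inner_products_summable f (hilbertBasis b).orthonormal
  have h : HasSum (fun k => ‖inner ℂ (hilbertBasis b k) f‖ ^ 2) (‖f‖ ^ 2) := by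
    have h1 := (hilbertBasis b).hasSum_inner_mul_inner f f
    rw [inner_self_eq_norm_sq_to_K] at h1
    have h2 : ∀ k, inner ℂ f (hilbertBasis b k) * inner ℂ (hilbertBasis b k) f =
        ((‖inner ℂ (hilbertBasis b k) f‖ ^ 2 : ℝ) : ℂ) := by
      intro k
      rw [← inner_conj_symm f, RCLike.conj_mul]
      norm_cast
    simp_rw [h2] at h1
    refine Complex.hasSum_ofReal.1 ?_
    rw [Complex.ofReal_pow]
    exact h1
  rw [← h.tsum_eq, ENNReal.ofReal_tsum_of_nonneg (fun _ => by positivity) hs]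
  refine tsum_congr fun k => ?_
  rw [ENNReal.ofReal_pow (norm_nonneg _), ofReal_norm]

variable {Ω : Type*} [MeasurableSpace Ω] {P : Measure Ω} [IsProbabilityMeasure P]
  {g : ℕ → Ω → ℂ}

/-- If an operator `A` increases the norms of the eigenfunctions at least by the order of
`λ_n^s`, then the image under `A` of a randomisation outside of `𝓗^s` is almost surely not
in `L²`. -/
lemma ae_not_memL2_map_randomisation
    (hg_meas : ∀ n, Measurable (g n)) (hg_indep : iIndepFun g P)
    (hg_law : ∀ n, P.map (g n) = stdComplexGaussian)
    {u : 𝓢'(EuclideanSpace ℝ (Fin d), ℂ)} {s : ℝ}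
    (hu : ∑' n, (ENNReal.ofReal (b.freq n ^ s) * ‖coeff b u n‖ₑ) ^ 2 = ∞)
    (A : 𝓢'(EuclideanSpace ℝ (Fin d), ℂ) →L[ℂ] 𝓢'(EuclideanSpace ℝ (Fin d), ℂ))
    (B : 𝓢(EuclideanSpace ℝ (Fin d), ℂ) → 𝓢(EuclideanSpace ℝ (Fin d), ℂ))
    (hAB : ∀ φ, A (SchwartzMap.toTemperedDistributionCLM (EuclideanSpace ℝ (Fin d)) ℂ volume φ) =
      SchwartzMap.toTemperedDistributionCLM (EuclideanSpace ℝ (Fin d)) ℂ volume (B φ))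
    (hB : ∃ c : ℝ, 0 < c ∧ ∀ n, c * b.freq n ^ (2 * s) ≤
      ‖(B (b.h n)).toLp 2 (volume : Measure (EuclideanSpace ℝ (Fin d)))‖ ^ 2) :
    ∀ᵐ ω ∂P, Summable (randomTerm b g u ω) → ¬ MemL2 (A (randomisation b g u ω)) := by
  obtain ⟨c, hc, hB⟩ := hB
  -- The coordinates of `c_n B h_n`; by Parseval row `n` has squared norm `|c_n|² ‖B h_n‖²`, at
  -- least `c λ_n^{2s} |c_n|²`.
  let w : ℕ → ℕ → ℂ := fun n k =>
    coeff b u n * inner ℂ (hilbertBasis b k) ((B (b.h n)).toLp 2 volume)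
  have hw : ∑' n, ∑' k, ‖w n k‖ₑ ^ 2 = ∞ := by
    have h1 : ∀ n, ENNReal.ofReal c * (ENNReal.ofReal (b.freq n ^ s) * ‖coeff b u n‖ₑ) ^ 2 ≤
        ∑' k, ‖w n k‖ₑ ^ 2 := by
      intro n
      have hfr := b.freq_pos n
      simp only [w, enorm_mul, mul_pow]
      rw [ENNReal.tsum_mul_left, tsum_enorm_sq_inner_hilbertBasis, mul_comm (‖coeff b u n‖ₑ ^ 2),
        ← mul_assoc, ← ENNReal.ofReal_pow (by positivity), ← ENNReal.ofReal_mul hc.le]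
      refine mul_le_mul_left (ENNReal.ofReal_le_ofReal ?_) _
      refine le_trans (le_of_eq ?_) (hB n)
      rw [← Real.rpow_natCast, ← Real.rpow_mul hfr.le, mul_comm s]
      norm_num
    refine top_unique ?_
    calc ∞ = ENNReal.ofReal c *
          ∑' n, (ENNReal.ofReal (b.freq n ^ s) * ‖coeff b u n‖ₑ) ^ 2 := by
            rw [hu, ENNReal.mul_top (by simpa using hc)]
      _ = ∑' n, ENNReal.ofReal c *
          (ENNReal.ofReal (b.freq n ^ s) * ‖coeff b u n‖ₑ) ^ 2 := ENNReal.tsum_mul_left.symm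
      _ ≤ _ := ENNReal.tsum_le_tsum h1
  filter_upwards [ae_not_summable_of_tsum_eq_top hg_meas hg_indep hg_law w hw] with ω hω hsum hmem
  obtain ⟨f, hf⟩ := hmem
  refine hω (fun k => inner ℂ (hilbertBasis b k) f) (fun k => ?_)
    (Orthonormal.inner_products_summable f (hilbertBasis b).orthonormal)
  -- Continuity of `A` and of the coefficient functionals makes the coefficients of `f` the limits
  -- of the Gaussian partial sums, although Bessel's inequality makes them square summable.
  have h1 := ((hsum.hasSum.mapL A).mapL (coeffCLM b k)).tendsto_sum_nat
  have h2 : coeffCLM b k (A (∑' n, randomTerm b g u ω n)) = inner ℂ (hilbertBasis b k) f := by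
    rw [← coeff_toTemperedDistribution, ← hf]
    rfl
  rw [h2] at h1
  refine h1.congr fun M => Finset.sum_congr rfl fun n _ => ?_
  rw [randomTerm, map_smul, map_smul, basisDist, hAB, coeffCLM_apply, coeff_schwartz, smul_eq_mul]
  ring

lemma smulLeftCLM_toTemperedDistributionCLM {a : EuclideanSpace ℝ (Fin d) → ℂ}
    (ha : a.HasTemperateGrowth) (φ : 𝓢(EuclideanSpace ℝ (Fin d), ℂ)) :
    TemperedDistribution.smulLeftCLM ℂ a
      (SchwartzMap.toTemperedDistributionCLM (EuclideanSpace ℝ (Fin d)) ℂ volume φ) =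
      SchwartzMap.toTemperedDistributionCLM (EuclideanSpace ℝ (Fin d)) ℂ volume
        (SchwartzMap.smulLeftCLM ℂ a φ) := by
  ext ψ
  rw [TemperedDistribution.smulLeftCLM_apply_apply,
    SchwartzMap.toTemperedDistributionCLM_apply_apply volume,
    SchwartzMap.toTemperedDistributionCLM_apply_apply volume]
  congr 1 with x
  rw [SchwartzMap.smulLeftCLM_apply_apply ha, SchwartzMap.smulLeftCLM_apply_apply ha]
  simp only [smul_eq_mul]
  ring

end Randomisation

end HarmonicRandomisation

end

theorem theorem1p1 {d : ℕ} (hd : 1 ≤ d) (b : HarmonicRandomisation.HermiteBasis d)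
    {Ω : Type*} [MeasurableSpace Ω] (P : Measure Ω) [IsProbabilityMeasure P]
    (g : ℕ → Ω → ℂ) (hg_meas : ∀ n, Measurable (g n)) (hg_indep : iIndepFun g P)
    (hg_law : ∀ n, P.map (g n) = HarmonicRandomisation.stdComplexGaussian)
    (σ : ℝ) (u₀ : 𝓢'(EuclideanSpace ℝ (Fin d), ℂ))
    (hu₀ : HarmonicRandomisation.MemHarmonicSobolev b σ u₀)
    (s : ℝ) (hs : 0 ≤ s) (hu₀s : ¬ HarmonicRandomisation.MemHarmonicSobolev b s u₀) :
    ∀ᵐ ω ∂P,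
      Summable (HarmonicRandomisation.randomTerm b g u₀ ω) ∧
      ¬ TemperedDistribution.MemSobolev s 2 (HarmonicRandomisation.randomisation b g u₀ ω) ∧
      ¬ HarmonicRandomisation.MemL2
          (TemperedDistribution.smulLeftCLM ℂ (HarmonicRandomisation.japaneseBracketPow d s)
            (HarmonicRandomisation.randomisation b g u₀ ω)) := by
  open HarmonicRandomisation in
  obtain ⟨hexp, m, hm⟩ := hu₀.hasSum_coeff
  have htop : ∑' n, (ENNReal.ofReal (b.freq n ^ s) * ‖coeff b u₀ n‖ₑ) ^ 2 = ∞ := by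
    by_contra h
    exact hu₀s (memHarmonicSobolev_of_tsum_ne_top b hexp h)
  have hgrowth := japaneseBracketPow_hasTemperateGrowth d s
  filter_upwards [ae_summable_norm_mul_sq hg_meas hg_law hm,
    ae_not_memL2_map_randomisation b hg_meas hg_indep hg_law htop
      (TemperedDistribution.besselPotential (EuclideanSpace ℝ (Fin d)) ℂ s)
      (SchwartzMap.fourierMultiplierCLM ℂ (japaneseBracketPow d s))
      (fun φ => TemperedDistribution.fourierMultiplierCLM_toTemperedDistributionCLM_eq hgrowth φ)
      (exists_lower_bound_bessel b hs),
    ae_not_memL2_map_randomisation b hg_meas hg_indep hg_law htop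
      (TemperedDistribution.smulLeftCLM ℂ (japaneseBracketPow d s))
      (SchwartzMap.smulLeftCLM ℂ (japaneseBracketPow d s))
      (smulLeftCLM_toTemperedDistributionCLM hgrowth)
      (exists_lower_bound_bracket b hs)] with ω hω hbessel hbracket
  have hsum : Summable (randomTerm b g u₀ ω) := by
    refine summable_smul_basisDist b m (hω.congr fun n => ?_)
    rw [mul_right_comm]
  -- `MemSobolev s 2` unfolds to `MemL2` of the Bessel potential.
  exact ⟨hsum, hbessel hsum, hbracket hsum⟩
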